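/- Let $n,J$ be natural numbers, let $r_1,\dots,r_J\in(0,1)$ be a ratio list, and let $D$ be its similarity dimension, i.e. the real number with $r_1^D+\cdots+r_J^D=1$. Assume $n-1<D<n$. Let $\mathfrak D=\{s\in\mathbb C: 1-\sum_{j=1}^J r_j^s=0\}$ be the set of complex dimensions. For an open set $U\subseteq\mathbb R^n$ let $V_U(\varepsilon)$ be the volume of its inner $\varepsilon$-tube $\{x\in U: d(x,\partial U)<\varepsilon\}$. Let $G\subseteq\mathbb R^n$ be an open set of finite volume with inradius $g$ (the supremum of the radii of balls contained in $G$) which is monophase: there are real numbers $\kappa_0,\dots,\kappa_{n-1}$ with \[V_G(\varepsilon)=\sum_{i=0}^{n-1}\kappa_i\,\varepsilon^{n-i}\ \text{ for } 0<\varepsilon<g,\qquad V_G(\varepsilon)=\mathrm{Vol}(G)\ \text{ for } \varepsilon\ge g,\] and put $\kappa_n=-\mathrm{Vol}(G)$. Let $(G_k)_{k\in\mathbb N}$ be a self-similar spray generated by $G$ with this ratio list: the $G_k$ are pairwise disjoint, and $G_k$ is the image of $G$ under a similarity of ratio $\lambda_k$, where $(\lambda_k)$ enumerates the products $r_{w_1}\cdots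 r_{w_l}$ over all finite words $w=w_1\cdots w_l$ in the letters $1,\dots,J$ (including the empty word, with product $1$), each word being used exactly once. Then, for $0<\varepsilon<g$, $V_{\cup G_k}(\varepsilon)$ is finite and \[V_{\cup G_k}(\varepsilon)=\sum_{\omega\in\mathfrak D\cup\{0,1,\dots,n-1\}}\operatorname{res}\left(\varepsilon^{n-s}\,\frac{\sum_{i=0}^{n}\kappa_i\frac{g^{s-i}}{s-i}}{1-\sum_{j=1}^J r_j^s}\,;\,\omega\right).\] The possibly infinite sum is understood as a limit of sums over bounded windows: there is a strictly increasing sequence $T_m\to\infty$, depending only on the ratio list, such that for each $m$ only finitely many $\omega\in\mathfrak D\cup\{0,1,\dots,n-1\}$ satisfy $|\operatorname{Im}\omega|\le T_m$, and for every such $G$ and spray and every $0<\varepsilon<g$ the sums of the residues at these $\omega$ converge to $V_{\cup G_k}(\varepsilon)$ as $m\to\infty$. -/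

import Mathlib

open scoped Topology

noncomputable section

namespace SelfSimilarSpray

/-- The inner `ε`-tube of `U`: the points of `U` at distance less than `ε` from the boundary. -/
def innerTube {n : ℕ} (U : Set (EuclideanSpace ℝ (Fin n))) (ε : ℝ) :
    Set (EuclideanSpace ℝ (Fin n)) :=
  {x ∈ U | Metric.infDist x (frontier U) < ε}

/-- The volume `V_U(ε)` of the inner `ε`-tube of `U`. -/
def innerTubeVolume {n : ℕ} (U : Set (EuclideanSpace ℝ (Fin n))) (ε : ℝ) : ℝ :=
  (MeasureTheory.volume (innerTube U ε)).toReal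

/-- The inradius of `G`: the supremum of the radii of the balls contained in `G`. -/
def inradius {n : ℕ} (G : Set (EuclideanSpace ℝ (Fin n))) : ℝ :=
  sSup {ρ : ℝ | ∃ x, Metric.ball x ρ ⊆ G}

/-- `H` is a scaled copy of `G` by the factor `c`: the image of `G` under a similarity of
ratio `c`. -/
def IsScaledCopy {n : ℕ} (c : ℝ) (G H : Set (EuclideanSpace ℝ (Fin n))) : Prop :=
  ∃ φ : EuclideanSpace ℝ (Fin n) → EuclideanSpace ℝ (Fin n),
    (∀ x y, dist (φ x) (φ y) = c * dist x y) ∧ H = φ '' G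

/-- `S` is a self-similar spray generated by `G` with ratio list `r`: its members are pairwise
disjoint, and they are scaled copies of `G` by the products `r_{w₁} ⋯ r_{w_l}`, where every
finite word `w` in the letters `1, …, J` (the empty word included) is used exactly once. -/
def IsSelfSimilarSpray {n J : ℕ} (r : Fin J → ℝ) (G : Set (EuclideanSpace ℝ (Fin n)))
    (S : ℕ → Set (EuclideanSpace ℝ (Fin n))) : Prop :=
  (∃ w : ℕ ≃ List (Fin J), ∀ k, IsScaledCopy ((w k).map r).prod G (S k)) ∧
    Pairwise (fun k l => Disjoint (S k) (S l))

/-- `G` is monophase with coefficients `κ 0, …, κ n`: up to the inradius its inner tube volume is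
the polynomial `∑_{i<n} κ i ε^(n-i)`, from the inradius on it is the volume of `G`, and `κ n`
denotes `-Vol(G)`. -/
structure IsMonophase {n : ℕ} (G : Set (EuclideanSpace ℝ (Fin n))) (κ : ℕ → ℝ) : Prop where
  tube_of_lt : ∀ ε, 0 < ε → ε < inradius G →
    innerTubeVolume G ε = ∑ i ∈ Finset.range n, κ i * ε ^ (n - i)
  tube_of_ge : ∀ ε, inradius G ≤ ε →
    innerTubeVolume G ε = (MeasureTheory.volume G).toReal
  top_coeff : κ n = -(MeasureTheory.volume G).toReal

/-- The complex dimensions: the zeros of `1 - ∑_j r_j^s`. -/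
def complexDimensions {J : ℕ} (r : Fin J → ℝ) : Set ℂ :=
  {s : ℂ | 1 - ∑ j, (r j : ℂ) ^ s = 0}

/-- The residue of `f` at an isolated singularity `z`: the integral
`(2πi)⁻¹ ∮ f` over the circle of radius `ρ` about `z`, which does not depend on `ρ` for small
`ρ > 0`. -/
def residue (f : ℂ → ℂ) (z : ℂ) : ℂ :=
  Filter.limUnder (𝓝[>] (0 : ℝ)) fun ρ : ℝ => (2 * Real.pi * Complex.I)⁻¹ * ∮ s in C(z, ρ), f s

/-- The function `ε^(n-s) (∑_{i=0}^n κ_i g^(s-i)/(s-i)) / (1 - ∑_j r_j^s)` of `s`. -/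
def tubeIntegrand (n : ℕ) {J : ℕ} (r : Fin J → ℝ) (κ : ℕ → ℝ) (g ε : ℝ) (s : ℂ) : ℂ :=
  (ε : ℂ) ^ ((n : ℂ) - s) *
    ((∑ i ∈ Finset.range (n + 1), (κ i : ℂ) * ((g : ℂ) ^ (s - (i : ℂ)) / (s - (i : ℂ)))) /
      (1 - ∑ j, (r j : ℂ) ^ s))

/-- The set `𝔇 ∪ {0, 1, …, n-1}` over which the residues are taken. -/
def tubePoles (n : ℕ) {J : ℕ} (r : Fin J → ℝ) : Set ℂ :=
  complexDimensions r ∪ {ω : ℂ | ∃ i : ℕ, i < n ∧ ω = (i : ℂ)}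

end SelfSimilarSpray

end

/-! Disjointness of the open copies makes the tube of the spray the disjoint union of the tubes of
its members, so its volume is the sum over words `w` of `λ_w^n V_G(ε/λ_w)`. For monophase `G`, the
Mellin transform of `V_G(x)/x^n` on the strip `n-1 < Re s < n` is `N(s) = ∑ κ_i g^(s-i)/(s-i)`.
Mellin inversion on a line `Re s = c` with `D < c < n`, and the geometric series `∑_w λ_w^s = 1/(1-∑
r_j^s)`, which converges absolutely there, express the volume as a vertical line integral of the
tube integrand.

The line is then pushed left by the residue theorem on the rectangles `[-T,c] × [-T,T]`. The other
three edges have total length `O(T)`, so a bound `O(T^(-2))` on them suffices. It has three sources.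
Left continuity of `V_G` at `g` gives `∑ κ_i g^(-i) = 0`, which improves the decay of the rational
factor of `N` from `1/|s|` to `1/|s|^2` (`norm_tubeNumerator_le`). Since `ε < g`, the factor
`(g/ε)^(Re s)` is bounded to the left of the line. The denominator is bounded below far to the left,
where the smallest ratio dominates (`exists_one_le_norm_expPoly_left`), and on suitable horizontal
lines, by almost periodicity (`exists_horizontal_lines`). The pole at `s = n` stays to the right of
the contour and contributes nothing. -/

namespace SelfSimilarSpray

open Complex Set MeasureTheory

/-! ### The residue theorem on rectangles. -/

/-- The integral of `f` along the positively oriented boundary of the rectangle with opposite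
corners `z` and `w`. -/
noncomputable def rectIntegral (f : ℂ → ℂ) (z w : ℂ) : ℂ :=
  (∫ x : ℝ in z.re..w.re, f (x + z.im * I)) - (∫ x : ℝ in z.re..w.re, f (x + w.im * I)) +
    I * (∫ y : ℝ in z.im..w.im, f (w.re + y * I)) - I * ∫ y : ℝ in z.im..w.im, f (z.re + y * I)

/-- The boundary of the rectangle with lower left corner `z` and upper right corner `w`. -/
def rectBoundary (z w : ℂ) : Set ℂ :=
  (Icc z.re w.re ×ℂ Icc z.im w.im) \ (Ioo z.re w.re ×ℂ Ioo z.im w.im)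

section Edges

variable {z w : ℂ}

theorem mem_rectBoundary_bottom (hre : z.re < w.re) (him : z.im < w.im) {x : ℝ}
    (hx : x ∈ uIcc z.re w.re) :
    (x + z.im * I : ℂ) ∈ rectBoundary z w := by
  rw [uIcc_of_le hre.le] at hx
  refine ⟨⟨by simpa using hx, by simpa using him.le⟩, fun h => ?_⟩
  simpa using h.2.1

theorem mem_rectBoundary_top (hre : z.re < w.re) (him : z.im < w.im) {x : ℝ}
    (hx : x ∈ uIcc z.re w.re) :
    (x + w.im * I : ℂ) ∈ rectBoundary z w := by
  rw [uIcc_of_le hre.le] at hx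
  refine ⟨⟨by simpa using hx, by simpa using him.le⟩, fun h => ?_⟩
  simpa using h.2.2

theorem mem_rectBoundary_left (hre : z.re < w.re) (him : z.im < w.im) {y : ℝ}
    (hy : y ∈ uIcc z.im w.im) :
    (z.re + y * I : ℂ) ∈ rectBoundary z w := by
  rw [uIcc_of_le him.le] at hy
  refine ⟨⟨by simpa using hre.le, by simpa using hy⟩, fun h => ?_⟩
  simpa using h.1.1

theorem mem_rectBoundary_right (hre : z.re < w.re) (him : z.im < w.im) {y : ℝ}
    (hy : y ∈ uIcc z.im w.im) :
    (w.re + y * I : ℂ) ∈ rectBoundary z w := by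
  rw [uIcc_of_le him.le] at hy
  refine ⟨⟨by simpa using hre.le, by simpa using hy⟩, fun h => ?_⟩
  simpa using h.1.2

theorem rectIntegral_congr (hre : z.re < w.re) (him : z.im < w.im) {f g : ℂ → ℂ}
    (h : EqOn f g (rectBoundary z w)) :
    rectIntegral f z w = rectIntegral g z w := by
  unfold rectIntegral
  congr 1
  · congr 1
    · congr 1
      · exact intervalIntegral.integral_congr fun x hx => h (mem_rectBoundary_bottom hre him hx)
      · exact intervalIntegral.integral_congr fun x hx => h (mem_rectBoundary_top hre him hx)
    · congr 1
      exact intervalIntegral.integral_congr fun x hx => h (mem_rectBoundary_right hre him hx)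
  · congr 1
    exact intervalIntegral.integral_congr fun x hx => h (mem_rectBoundary_left hre him hx)

theorem intervalIntegrable_rectBoundary (hre : z.re < w.re) (him : z.im < w.im) {f : ℂ → ℂ}
    (hf : ContinuousOn f (rectBoundary z w)) :
    IntervalIntegrable (fun x : ℝ => f (x + z.im * I)) volume z.re w.re ∧
    IntervalIntegrable (fun x : ℝ => f (x + w.im * I)) volume z.re w.re ∧
    IntervalIntegrable (fun y : ℝ => f (w.re + y * I)) volume z.im w.im ∧
    IntervalIntegrable (fun y : ℝ => f (z.re + y * I)) volume z.im w.im :=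
  ⟨(hf.comp (by fun_prop) fun _ hx => mem_rectBoundary_bottom hre him hx).intervalIntegrable,
    (hf.comp (by fun_prop) fun _ hx => mem_rectBoundary_top hre him hx).intervalIntegrable,
    (hf.comp (by fun_prop) fun _ hx => mem_rectBoundary_right hre him hx).intervalIntegrable,
    (hf.comp (by fun_prop) fun _ hx => mem_rectBoundary_left hre him hx).intervalIntegrable⟩

theorem rectIntegral_add (hre : z.re < w.re) (him : z.im < w.im) {f g : ℂ → ℂ}
    (hf : ContinuousOn f (rectBoundary z w))
    (hg : ContinuousOn g (rectBoundary z w)) :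
    rectIntegral (fun s => f s + g s) z w = rectIntegral f z w + rectIntegral g z w := by
  obtain ⟨f1, f2, f3, f4⟩ := intervalIntegrable_rectBoundary hre him hf
  obtain ⟨g1, g2, g3, g4⟩ := intervalIntegrable_rectBoundary hre him hg
  unfold rectIntegral
  rw [intervalIntegral.integral_add f1 g1, intervalIntegral.integral_add f2 g2,
    intervalIntegral.integral_add f3 g3, intervalIntegral.integral_add f4 g4]
  ring

theorem rectIntegral_const_mul (c : ℂ) (f : ℂ → ℂ) :
    rectIntegral (fun s => c * f s) z w = c * rectIntegral f z w := by
  unfold rectIntegral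
  simp only [intervalIntegral.integral_const_mul]
  ring

theorem rectIntegral_zero : rectIntegral (fun _ => 0) z w = 0 := by
  simp [rectIntegral]

theorem rectIntegral_sum (hre : z.re < w.re) (him : z.im < w.im) {ι : Type*}
    (P : Finset ι) {f : ι → ℂ → ℂ}
    (hf : ∀ i ∈ P, ContinuousOn (f i) (rectBoundary z w)) :
    rectIntegral (fun s => ∑ i ∈ P, f i s) z w = ∑ i ∈ P, rectIntegral (f i) z w := by
  classical
  induction P using Finset.induction_on with
  | empty => simpa using rectIntegral_zero
  | insert a P ha ih =>
    simp only [Finset.sum_insert ha]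
    rw [rectIntegral_add hre him (hf a (Finset.mem_insert_self _ _))
      (continuousOn_finsetSum _ fun i hi => hf i (Finset.mem_insert_of_mem hi)),
      ih fun i hi => hf i (Finset.mem_insert_of_mem hi)]

end Edges

theorem integral_horizontal_eq_sub {F f : ℂ → ℂ} {a b y : ℝ}
    (h : ∀ x ∈ uIcc a b, HasDerivAt F (f (x + y * I)) (x + y * I))
    (hi : IntervalIntegrable (fun x : ℝ => f (x + y * I)) volume a b) :
    ∫ x : ℝ in a..b, f (x + y * I) = F (b + y * I) - F (a + y * I) := by
  refine intervalIntegral.integral_eq_sub_of_hasDerivAt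
    (f := fun x : ℝ => F (x + y * I)) (fun x hx => ?_) hi
  have h1 : HasDerivAt (fun x : ℝ => (x + y * I : ℂ)) 1 x :=
    (hasDerivAt_id x).ofReal_comp.add_const _
  simpa [Function.comp_def] using (h x hx).comp x h1

theorem integral_vertical_eq_sub {F f : ℂ → ℂ} {a b x : ℝ}
    (h : ∀ y ∈ uIcc a b, HasDerivAt F (f (x + y * I)) (x + y * I))
    (hi : IntervalIntegrable (fun y : ℝ => f (x + y * I)) volume a b) :
    I * ∫ y : ℝ in a..b, f (x + y * I) = F (x + b * I) - F (x + a * I) := by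
  rw [← intervalIntegral.integral_const_mul]
  refine intervalIntegral.integral_eq_sub_of_hasDerivAt
    (f := fun y : ℝ => F (x + y * I)) (fun y hy => ?_) (hi.const_mul I)
  have h1 : HasDerivAt (fun y : ℝ => (x + y * I : ℂ)) I y := by
    simpa using ((hasDerivAt_id y).ofReal_comp.mul_const I).const_add (x : ℂ)
  simpa [Function.comp_def, mul_comm] using (h y hy).comp y h1

theorem rectIntegral_eq_zero_of_hasDerivAt {F f : ℂ → ℂ} {z w : ℂ} (hre : z.re < w.re)
    (him : z.im < w.im) (hf : ContinuousOn f (rectBoundary z w))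
    (h : ∀ s ∈ rectBoundary z w, HasDerivAt F (f s) s) : rectIntegral f z w = 0 := by
  obtain ⟨f1, f2, f3, f4⟩ := intervalIntegrable_rectBoundary hre him hf
  unfold rectIntegral
  rw [integral_horizontal_eq_sub (fun x hx => h _ (mem_rectBoundary_bottom hre him hx)) f1,
    integral_horizontal_eq_sub (fun x hx => h _ (mem_rectBoundary_top hre him hx)) f2,
    integral_vertical_eq_sub (fun x hx => h _ (mem_rectBoundary_right hre him hx)) f3,
    integral_vertical_eq_sub (fun x hx => h _ (mem_rectBoundary_left hre him hx)) f4]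
  ring

/-- This is the jump between the branches of the logarithm used on two adjacent edges of a
rectangle, evaluated at their common corner. -/
theorem log_I_mul {a : ℂ} (ha : 0 < a.re) : log (I * a) = log a + Real.pi / 2 * I := by
  have ha0 : a ≠ 0 := by rintro rfl; simp at ha
  have h := abs_lt.1 (abs_arg_lt_pi_div_two_iff.2 (Or.inl ha))
  rw [log_mul I_ne_zero ha0, log_I]
  · ring
  · rw [arg_I]
    constructor <;> linarith [Real.pi_pos]

/-- Each edge lies in an open half plane bounded by a line through `p`. The rotation `u` turns it
into the right half plane, away from the cut of `log`. -/
theorem hasDerivAt_log_mul_sub {u p s : ℂ} (hs : 0 < (u * (s - p)).re) :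
    HasDerivAt (fun s => log (u * (s - p))) ((s - p)⁻¹) s := by
  have h0 : u * (s - p) ≠ 0 := by
    intro h; rw [h] at hs; simp at hs
  have h1 : HasDerivAt (fun s => u * (s - p)) u s := by
    simpa using ((hasDerivAt_id s).sub_const p).const_mul u
  convert h1.clog (Or.inl hs) using 1
  rw [mul_ne_zero_iff] at h0
  field_simp [h0.1, h0.2]

theorem ne_of_mem_rectBoundary {p s z w : ℂ} (hp : p ∈ Ioo z.re w.re ×ℂ Ioo z.im w.im)
    (hs : s ∈ rectBoundary z w) : s ≠ p := by
  rintro rfl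
  exact hs.2 hp

theorem continuousOn_zpow_rectBoundary {p z w : ℂ} (hp : p ∈ Ioo z.re w.re ×ℂ Ioo z.im w.im)
    (k : ℤ) : ContinuousOn (fun s => (s - p) ^ k) (rectBoundary z w) :=
  (by fun_prop : ContinuousOn (fun s => s - p) _).zpow₀ k fun _ hs =>
    Or.inl (sub_ne_zero.2 (ne_of_mem_rectBoundary hp hs))

/-- Each edge has its own primitive, a rotated branch of the logarithm. At each of the four corners
the two branches differ by `πi/2`, and these jumps add up to `2πi`. -/
theorem rectIntegral_inv_sub {p z w : ℂ} (hp : p ∈ Ioo z.re w.re ×ℂ Ioo z.im w.im) :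
    rectIntegral (fun s => (s - p)⁻¹) z w = 2 * Real.pi * I := by
  have hre := hp.1.1.trans hp.1.2
  have him := hp.2.1.trans hp.2.2
  have hc : ContinuousOn (fun s => (s - p)⁻¹) (rectBoundary z w) := by
    simpa using continuousOn_zpow_rectBoundary hp (-1)
  obtain ⟨⟨h1, h2⟩, h3, h4⟩ := hp
  change z.re < p.re at h1
  change p.re < w.re at h2
  change z.im < p.im at h3
  change p.im < w.im at h4
  obtain ⟨f1, f2, f3, f4⟩ := intervalIntegrable_rectBoundary hre him hc
  unfold rectIntegral
  rw [integral_horizontal_eq_sub (F := fun s => log (I * (s - p))) (f := fun s => (s - p)⁻¹)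
      (fun x _ => hasDerivAt_log_mul_sub (by simpa using h3)) f1,
    integral_horizontal_eq_sub (F := fun s => log (-I * (s - p))) (f := fun s => (s - p)⁻¹)
      (fun x _ => hasDerivAt_log_mul_sub (by simpa using h4)) f2,
    integral_vertical_eq_sub (F := fun s => log (1 * (s - p))) (f := fun s => (s - p)⁻¹)
      (fun x _ => hasDerivAt_log_mul_sub (by simpa using h2)) f3,
    integral_vertical_eq_sub (F := fun s => log (-1 * (s - p))) (f := fun s => (s - p)⁻¹)
      (fun x _ => hasDerivAt_log_mul_sub (by simpa using h1)) f4]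
  have e1 := log_I_mul (a := w.re + z.im * I - p) (by simpa using h2)
  have e2 := log_I_mul (a := -I * (w.re + w.im * I - p)) (by simpa using h4)
  have e3 := log_I_mul (a := -1 * (z.re + w.im * I - p)) (by simpa using h1)
  have e4 := log_I_mul (a := I * (z.re + z.im * I - p)) (by simpa using h3)
  rw [← mul_assoc, show I * -I = 1 by simp] at e2
  rw [← mul_assoc, show I * -1 = -I by simp] at e3
  rw [← mul_assoc, show I * I = -1 by simp] at e4
  rw [e1, e2, e3, e4]
  ring_nf

theorem rectIntegral_zpow {p z w : ℂ} (hp : p ∈ Ioo z.re w.re ×ℂ Ioo z.im w.im) {k : ℤ}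
    (hk : k ≠ -1) : rectIntegral (fun s => (s - p) ^ k) z w = 0 := by
  have hk' : (k + 1 : ℂ) ≠ 0 := by
    exact_mod_cast fun h : k + 1 = 0 => hk (by omega)
  refine rectIntegral_eq_zero_of_hasDerivAt (F := fun s => (s - p) ^ (k + 1) / (k + 1))
    (hp.1.1.trans hp.1.2) (hp.2.1.trans hp.2.2) (continuousOn_zpow_rectBoundary hp k) fun s hs => ?_
  have h := (hasDerivAt_zpow (k + 1) (s - p)
    (Or.inl (sub_ne_zero.2 (ne_of_mem_rectBoundary hp hs)))).comp s ((hasDerivAt_id s).sub_const p)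
  refine (h.div_const (k + 1 : ℂ)).congr_deriv ?_
  rw [add_sub_cancel_right]
  push_cast
  field_simp

/-- A finite principal part at `p`. -/
noncomputable def principalPart (b : ℕ → ℂ) (k : ℕ) (p s : ℂ) : ℂ :=
  ∑ j ∈ Finset.range k, b j * (s - p) ^ (-(j + 1 : ℤ))

/-- Induction on the pole order: writing `h(s) = h(p) + (s-p) · dslope h p s` splits off the
coefficient of highest order and leaves a pole of order one less. -/
theorem exists_principalPart {f : ℂ → ℂ} {p : ℂ} (hf : MeromorphicAt f p) :
    ∃ (b : ℕ → ℂ) (k : ℕ) (g : ℂ → ℂ), AnalyticAt ℂ g p ∧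
      ∀ᶠ s in 𝓝[≠] p, f s = principalPart b k p s + g s := by
  have key : ∀ (k : ℕ) (h : ℂ → ℂ), AnalyticAt ℂ h p →
      ∃ (b : ℕ → ℂ) (g : ℂ → ℂ), AnalyticAt ℂ g p ∧
        ∀ s, s ≠ p → (s - p) ^ (-(k : ℤ)) * h s = principalPart b k p s + g s := by
    intro k
    induction k with
    | zero => exact fun h hh => ⟨0, h, hh, by simp [principalPart]⟩
    | succ k ih =>
      intro h hh
      have hd : AnalyticAt ℂ (dslope h p) p := by
        obtain ⟨q, hq⟩ := hh
        exact ⟨_, hq.has_fpower_series_dslope_fslope⟩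
      obtain ⟨b, g, hg, hbg⟩ := ih _ hd
      refine ⟨fun j => if j = k then h p else b j, g, hg, fun s hs => ?_⟩
      have hs' := sub_ne_zero.2 hs
      have e1 : h s = h p + (s - p) * dslope h p s := by
        rw [dslope_of_ne _ hs, ← smul_eq_mul, sub_smul_slope]
        simp
      have e2 : (s - p) ^ (-((k + 1 : ℕ) : ℤ)) * (s - p) = (s - p) ^ (-(k : ℤ)) := by
        rw [← zpow_add_one₀ hs']
        congr 1
        push_cast
        ring
      have e3 : principalPart (fun j => if j = k then h p else b j) (k + 1) p s
          = principalPart b k p s + h p * (s - p) ^ (-((k + 1 : ℕ) : ℤ)) := by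
        unfold principalPart
        rw [Finset.sum_range_succ]
        congr 1
        · refine Finset.sum_congr rfl fun j hj => ?_
          simp [(Finset.mem_range.1 hj).ne]
        · simp
      rw [e1, mul_add, ← mul_assoc, e2, hbg s hs, e3]
      ring
  obtain ⟨k, hk⟩ := hf
  obtain ⟨b, g, hg, hbg⟩ := key k _ hk
  refine ⟨b, k, g, hg, ?_⟩
  filter_upwards [self_mem_nhdsWithin] with s hs
  rw [← hbg s hs, smul_eq_mul, ← mul_assoc, ← zpow_natCast, ← zpow_add₀ (sub_ne_zero.2 hs)]
  simp

/-- The functional `L` is left abstract to serve both the circle and the rectangle. -/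
theorem sum_mul_zpow_integral {L : ((ℂ → ℂ) → ℂ)} (b : ℕ → ℂ) (k : ℕ) (p : ℂ)
    (h1 : L (fun s => (s - p)⁻¹) = 2 * Real.pi * I)
    (h0 : ∀ m : ℤ, m ≠ -1 → L (fun s => (s - p) ^ m) = 0) :
    ∑ j ∈ Finset.range k, b j * L (fun s => (s - p) ^ (-(j + 1 : ℤ))) =
      2 * Real.pi * I * if 0 < k then b 0 else 0 := by
  cases k with
  | zero => simp
  | succ k =>
    rw [Finset.sum_range_succ', Finset.sum_eq_zero fun j _ => by rw [h0 _ (by omega), mul_zero]]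
    simp [h1, mul_comm]

theorem circleIntegral_principalPart (b : ℕ → ℂ) (k : ℕ) (p : ℂ) {ρ : ℝ} (hρ : 0 < ρ) :
    ∮ s in C(p, ρ), principalPart b k p s = 2 * Real.pi * I * if 0 < k then b 0 else 0 := by
  unfold principalPart
  have hint : ∀ j ∈ Finset.range k,
      CircleIntegrable (fun s => b j * (s - p) ^ (-(j + 1 : ℤ))) p ρ := by
    intro j _
    refine ContinuousOn.circleIntegrable hρ.le (continuousOn_const.mul
      ((by fun_prop : ContinuousOn (fun s => s - p) _).zpow₀ _ fun s hs => Or.inl ?_))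
    rintro h
    rw [sub_eq_zero.1 h] at hs
    simp [hρ.ne] at hs
  rw [circleIntegral.integral_fun_sum hint]
  simp only [circleIntegral.integral_const_mul]
  exact sum_mul_zpow_integral (L := fun f => ∮ s in C(p, ρ), f s) b k p
    (circleIntegral.integral_sub_center_inv _ hρ.ne')
    fun m hm => circleIntegral.integral_sub_zpow_of_ne hm _ _ _

theorem continuousOn_principalPart {p z w : ℂ} (hp : p ∈ Ioo z.re w.re ×ℂ Ioo z.im w.im)
    (b : ℕ → ℂ) (k : ℕ) : ContinuousOn (principalPart b k p) (rectBoundary z w) :=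
  continuousOn_finsetSum _ fun _ _ => continuousOn_const.mul (continuousOn_zpow_rectBoundary hp _)

theorem rectIntegral_principalPart {p z w : ℂ} (hp : p ∈ Ioo z.re w.re ×ℂ Ioo z.im w.im)
    (b : ℕ → ℂ) (k : ℕ) :
    rectIntegral (principalPart b k p) z w = 2 * Real.pi * I * if 0 < k then b 0 else 0 := by
  unfold principalPart
  rw [rectIntegral_sum (hp.1.1.trans hp.1.2) (hp.2.1.trans hp.2.2) (Finset.range k)
    (f := fun j s => b j * (s - p) ^ (-(j + 1 : ℤ))) fun j _ => continuousOn_const.mul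
      (continuousOn_zpow_rectBoundary hp _)]
  simp only [rectIntegral_const_mul]
  exact sum_mul_zpow_integral (L := fun f => rectIntegral f z w) b k p
    (rectIntegral_inv_sub hp) fun m hm => rectIntegral_zpow hp hm

/-- On every sufficiently small circle the analytic part integrates to zero, so the expression in
the limit is eventually constant in the radius. -/
theorem residue_eq_of_principalPart {f g : ℂ → ℂ} {p : ℂ} {b : ℕ → ℂ} {k : ℕ}
    (hg : AnalyticAt ℂ g p) (h : ∀ᶠ s in 𝓝[≠] p, f s = principalPart b k p s + g s) :
    residue f p = if 0 < k then b 0 else 0 := by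
  refine Filter.Tendsto.limUnder_eq (tendsto_const_nhds.congr' ?_)
  obtain ⟨δ, hδ, hδ'⟩ := Metric.eventually_nhds_iff.1
    ((eventually_nhdsWithin_iff.1 h).and hg.eventually_analyticAt)
  filter_upwards [Ioo_mem_nhdsGT hδ] with ρ hρ
  have hgd : DifferentiableOn ℂ g (Metric.closedBall p ρ) := fun s hs =>
    (hδ' ((Metric.mem_closedBall.1 hs).trans_lt hρ.2)).2.differentiableAt.differentiableWithinAt
  have hne : ∀ s ∈ Metric.sphere p ρ, s ≠ p := by
    rintro s hs rfl
    simp [hρ.1.ne] at hs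
  have e : ∮ s in C(p, ρ), f s = ∮ s in C(p, ρ), (principalPart b k p s + g s) :=
    circleIntegral.integral_congr hρ.1.le fun s hs =>
      (hδ' ((Metric.mem_sphere.1 hs).trans_lt hρ.2)).1 (hne s hs)
  have hpp : ContinuousOn (principalPart b k p) (Metric.sphere p ρ) :=
    continuousOn_finsetSum _ fun _ _ => continuousOn_const.mul
      ((by fun_prop : ContinuousOn (fun s => s - p) _).zpow₀ _ fun s hs =>
        Or.inl (sub_ne_zero.2 (hne s hs)))
  rw [e, circleIntegral.integral_add (hpp.circleIntegrable hρ.1.le)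
    ((hgd.continuousOn.mono Metric.sphere_subset_closedBall).circleIntegrable hρ.1.le),
    circleIntegral_principalPart b k p hρ.1,
    Complex.circleIntegral_eq_zero_of_differentiable_on_off_countable hρ.1.le
      Set.countable_empty hgd.continuousOn fun s hs => (hδ' ((Metric.mem_ball.1 hs.1).trans
        hρ.2)).2.differentiableAt, add_zero, inv_mul_cancel_left₀ two_pi_I_ne_zero]

theorem differentiableAt_principalPart {b : ℕ → ℂ} {k : ℕ} {p s : ℂ} (hs : s ≠ p) :
    DifferentiableAt ℂ (principalPart b k p) s :=
  DifferentiableAt.fun_sum fun _ _ => (DifferentiableAt.zpow (f := fun s => s - p) (by fun_prop)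
    (Or.inl (sub_ne_zero.2 hs))).const_mul _

/-- The residue theorem on a rectangle. -/
theorem rectIntegral_eq_sum_residue {f : ℂ → ℂ} {z w : ℂ} (hre : z.re < w.re) (him : z.im < w.im)
    (P : Finset ℂ) (hP : ∀ p ∈ P, p ∈ Ioo z.re w.re ×ℂ Ioo z.im w.im)
    (hm : ∀ p ∈ P, MeromorphicAt f p)
    (hf : ∀ s ∈ Icc z.re w.re ×ℂ Icc z.im w.im, s ∉ P → DifferentiableAt ℂ f s) :
    rectIntegral f z w = 2 * Real.pi * I * ∑ p ∈ P, residue f p := by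
  classical
  choose! b k g hg hbg using fun p hp => exists_principalPart (hm p hp)
  set F : ℂ → ℂ := fun s => f s - ∑ p ∈ P, principalPart (b p) (k p) p s with hF
  -- `F` has only removable singularities, but its values at the points of `P` are arbitrary; `G`
  -- replaces them by the limits, so that Cauchy's theorem applies.
  set G : ℂ → ℂ := fun s => if s ∈ P then Filter.limUnder (𝓝[≠] s) F else F s with hGdef
  have hPnhds : ∀ s, ∀ᶠ t in 𝓝[≠] s, t ∉ P := fun s => by
    have : ∀ᶠ t in 𝓝 s, t ∉ P.erase s :=
      (P.erase s).finite_toSet.isClosed.isOpen_compl.mem_nhds (by simp)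
    filter_upwards [eventually_nhdsWithin_of_eventually_nhds this, self_mem_nhdsWithin]
      with t ht hts htP
    exact ht (Finset.mem_erase.2 ⟨hts, htP⟩)
  have hG : ∀ s ∈ Icc z.re w.re ×ℂ Icc z.im w.im, DifferentiableAt ℂ G s := by
    intro s hs
    by_cases hsP : s ∈ P
    -- The principal parts at the other poles are regular at `s`, so `g'` is the extension of `F`
    -- across `s`.
    · set g' : ℂ → ℂ := fun t => g s t - ∑ p ∈ P.erase s, principalPart (b p) (k p) p t
      have hg' : DifferentiableAt ℂ g' s := (hg s hsP).differentiableAt.sub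
        (DifferentiableAt.fun_sum fun p hp =>
          differentiableAt_principalPart (Finset.ne_of_mem_erase hp).symm)
      have e : F =ᶠ[𝓝[≠] s] g' := by
        filter_upwards [hbg s hsP] with t ht
        simp only [hF, g', ht, ← Finset.add_sum_erase P _ hsP]
        ring
      have hGs : G s = g' s := by
        simp only [hGdef, if_pos hsP]
        exact ((hg'.continuousAt.tendsto.mono_left nhdsWithin_le_nhds).congr' e.symm).limUnder_eq
      refine hg'.congr_of_eventuallyEq ?_
      filter_upwards [eventually_nhdsWithin_iff.1 (e.and (hPnhds s))] with t ht
      rcases eq_or_ne t s with rfl | hts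
      · exact hGs
      · simp only [hGdef, if_neg (ht hts).2, (ht hts).1]
    · have hFs : DifferentiableAt ℂ F s := (hf s hs hsP).sub
        (DifferentiableAt.fun_sum fun p hp =>
          differentiableAt_principalPart fun h => hsP (h ▸ hp))
      have hev : ∀ᶠ t in 𝓝 s, t ∉ P :=
        P.finite_toSet.isClosed.isOpen_compl.mem_nhds (by simpa using hsP)
      refine hFs.congr_of_eventuallyEq (hev.mono fun t ht => ?_)
      simp only [hGdef, if_neg ht]
  have hG0 : rectIntegral G z w = 0 := by
    have := Complex.integral_boundary_rect_eq_zero_of_differentiableOn G z w fun s hs =>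
      (hG s (by rwa [uIcc_of_le hre.le, uIcc_of_le him.le] at hs)).differentiableWithinAt
    simpa [rectIntegral, smul_eq_mul] using this
  have hGc : ContinuousOn G (rectBoundary z w) := fun s hs =>
    (hG s hs.1).continuousAt.continuousWithinAt
  have hsum : ∀ p ∈ P, ContinuousOn (principalPart (b p) (k p) p) (rectBoundary z w) :=
    fun p hp => continuousOn_principalPart (hP p hp) _ _
  have e : EqOn f (fun s => G s + ∑ p ∈ P, principalPart (b p) (k p) p s) (rectBoundary z w) := by
    intro s hs
    have : s ∉ P := fun h => hs.2 (hP s h)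
    simp [hGdef, if_neg this, hF]
  rw [rectIntegral_congr hre him e, rectIntegral_add hre him hGc (continuousOn_finsetSum _ hsum),
    hG0, zero_add, rectIntegral_sum hre him P hsum, Finset.mul_sum]
  refine Finset.sum_congr rfl fun p hp => ?_
  rw [rectIntegral_principalPart (hP p hp), residue_eq_of_principalPart (hg p hp) (hbg p hp)]

end SelfSimilarSpray

/-! ### Similarities and the inner tube of a spray. -/

namespace SelfSimilarSpray

open Set MeasureTheory
open scoped Pointwise

section Similarity

variable {n : ℕ}

local notation "E" => EuclideanSpace ℝ (Fin n)

/-- After division by `c` the map is an isometry, hence affine because the norm is strictly convex.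
Its linear part is onto by equality of dimensions. -/
theorem exists_linearIsometryEquiv_of_dist {c : ℝ} (hc : 0 < c) {φ : E → E}
    (h : ∀ x y, dist (φ x) (φ y) = c * dist x y) :
    ∃ (L : E ≃ₗᵢ[ℝ] E) (b : E), ∀ x, φ x = c • (L x + b) := by
  have hi : Isometry fun x => c⁻¹ • φ x := Isometry.of_dist_eq fun x y => by
    rw [dist_smul₀, h, Real.norm_eq_abs, abs_of_pos (inv_pos.2 hc), inv_mul_cancel_left₀ hc.ne']
  refine ⟨hi.affineIsometryOfStrictConvexSpace.linearIsometry.toLinearIsometryEquiv rfl,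
    c⁻¹ • φ 0, fun x => ?_⟩
  have e := hi.affineIsometryOfStrictConvexSpace.map_vadd 0 x
  simp only [vadd_eq_add, add_zero, Isometry.affineIsometryOfStrictConvexSpace_apply] at e
  rw [LinearIsometry.coe_toLinearIsometryEquiv, ← e, smul_inv_smul₀ hc.ne']

theorem isHomeomorph_smul_add {c : ℝ} (hc : 0 < c) (L : E ≃ₗᵢ[ℝ] E) (b : E) :
    IsHomeomorph fun x => c • (L x + b) :=
  ((L.toHomeomorph.trans (Homeomorph.addRight b)).trans
    (Homeomorph.smulOfNeZero c hc.ne')).isHomeomorph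

theorem infDist_smul_add_image {c : ℝ} (hc : 0 < c) (L : E ≃ₗᵢ[ℝ] E) (b x : E) (s : Set E) :
    Metric.infDist (c • (L x + b)) ((fun x => c • (L x + b)) '' s) = c * Metric.infDist x s := by
  have hi : Isometry fun x => L x + b := (IsometryEquiv.addRight b).isometry.comp L.isometry
  have e : (fun x => c • (L x + b)) '' s = c • ((fun x => L x + b) '' s) := by
    rw [← image_smul, image_image]
  rw [e, infDist_smul₀ hc.ne', Metric.infDist_image hi, Real.norm_eq_abs, abs_of_pos hc]

theorem volume_smul_add_image {c : ℝ} (hc : 0 < c) (L : E ≃ₗᵢ[ℝ] E) (b : E) (s : Set E) :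
    volume ((fun x => c • (L x + b)) '' s) = ENNReal.ofReal (c ^ n) * volume s := by
  have e : (fun x => c • (L x + b)) '' s = c • ((fun x => x + b) '' (L '' s)) := by
    rw [← image_smul, image_image, image_image]
  have e2 : volume (L '' s) = volume s := by
    rw [show L '' s = L.symm ⁻¹' s from L.toEquiv.image_eq_preimage_symm s]
    exact L.symm.measurePreserving.measure_preimage_emb
      L.symm.toHomeomorph.measurableEmbedding s
  rw [e, Measure.addHaar_smul, image_add_right, measure_preimage_add_right, e2,
    finrank_euclideanSpace_fin, abs_of_pos (pow_pos hc n)]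

theorem innerTube_smul_add_image {c : ℝ} (hc : 0 < c) (L : E ≃ₗᵢ[ℝ] E) (b : E) (G : Set E)
    (ε : ℝ) : innerTube ((fun x => c • (L x + b)) '' G) ε =
      (fun x => c • (L x + b)) '' innerTube G (ε / c) := by
  have hh := isHomeomorph_smul_add hc L b
  ext y
  unfold innerTube
  rw [← hh.image_frontier]
  constructor
  · rintro ⟨⟨x, hx, rfl⟩, hy⟩
    refine ⟨x, ⟨hx, ?_⟩, rfl⟩
    rw [infDist_smul_add_image hc] at hy
    rwa [lt_div_iff₀' hc]
  · rintro ⟨x, ⟨hx, hx'⟩, rfl⟩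
    refine ⟨⟨x, hx, rfl⟩, ?_⟩
    rw [infDist_smul_add_image hc]
    rwa [lt_div_iff₀' hc] at hx'

namespace IsScaledCopy

variable {c : ℝ} {G H : Set (EuclideanSpace ℝ (Fin n))}

theorem isOpen (h : IsScaledCopy c G H) (hc : 0 < c) (hG : IsOpen G) : IsOpen H := by
  obtain ⟨φ, hφ, rfl⟩ := h
  obtain ⟨L, b, hL⟩ := exists_linearIsometryEquiv_of_dist hc hφ
  obtain rfl : φ = fun x => c • (L x + b) := funext hL
  exact (isHomeomorph_smul_add hc L b).isOpenMap _ hG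

theorem volume_eq (h : IsScaledCopy c G H) (hc : 0 < c) :
    volume H = ENNReal.ofReal (c ^ n) * volume G := by
  obtain ⟨φ, hφ, rfl⟩ := h
  obtain ⟨L, b, hL⟩ := exists_linearIsometryEquiv_of_dist hc hφ
  obtain rfl : φ = fun x => c • (L x + b) := funext hL
  exact volume_smul_add_image hc L b G

theorem volume_innerTube (h : IsScaledCopy c G H) (hc : 0 < c) (ε : ℝ) :
    volume (innerTube H ε) = ENNReal.ofReal (c ^ n) * volume (innerTube G (ε / c)) := by
  obtain ⟨φ, hφ, rfl⟩ := h
  obtain ⟨L, b, hL⟩ := exists_linearIsometryEquiv_of_dist hc hφ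
  obtain rfl : φ = fun x => c • (L x + b) := funext hL
  rw [innerTube_smul_add_image hc, volume_smul_add_image hc]

end IsScaledCopy

theorem isOpen_innerTube {U : Set E} (hU : IsOpen U) (ε : ℝ) : IsOpen (innerTube U ε) :=
  hU.inter (isOpen_lt (Metric.continuous_infDist_pt _) continuous_const)

/-- A proper nonempty subset has nonempty frontier, without which `Metric.infDist` takes the default
value `0`. In dimension zero the whole space has finite volume, hence `n ≠ 0`. -/
theorem ne_univ_of_volume_ne_top (hn : n ≠ 0) {U : Set E} (hU : volume U ≠ ⊤) : U ≠ univ := by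
  rintro rfl
  have : Nonempty (Fin n) := ⟨⟨0, Nat.pos_of_ne_zero hn⟩⟩
  exact hU (measure_univ_of_isAddLeftInvariant _)

/-- A frontier point of `S k` cannot lie in another member, as that member is open and disjoint from
`S k`; this gives `≤`. Conversely, the frontier of the union avoids `S k`, and a point of the
complement of `S k` nearest to `x` can be found on the frontier of `S k`. -/
theorem infDist_frontier_iUnion {S : ℕ → Set E} (hS : ∀ k, IsOpen (S k))
    (hd : Pairwise fun k l => Disjoint (S k) (S l)) (hne : ∀ k, S k ≠ univ) {k : ℕ} {x : E}
    (hx : x ∈ S k) : Metric.infDist x (frontier (⋃ k, S k)) = Metric.infDist x (frontier (S k)) := by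
  have hsub : frontier (S k) ⊆ frontier (⋃ k, S k) := by
    intro y hy
    rw [(isOpen_iUnion hS).frontier_eq]
    refine ⟨closure_mono (subset_iUnion S k) hy.1, fun hy' => ?_⟩
    obtain ⟨l, hl⟩ := mem_iUnion.1 hy'
    rcases eq_or_ne l k with rfl | hlk
    · rw [(hS l).frontier_eq] at hy
      exact hy.2 hl
    · obtain ⟨z, hz, hz'⟩ := mem_closure_iff.1 hy.1 _ (hS l) hl
      exact (disjoint_left.1 (hd hlk) hz) hz'
  obtain ⟨y, hy, hxy⟩ := exists_mem_frontier_infDist_compl_eq_dist hx (hne k)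
  refine le_antisymm (Metric.infDist_le_infDist_of_subset hsub ⟨y, hy⟩) ?_
  refine (Metric.infDist_le_dist_of_mem hy).trans (hxy ▸ ?_)
  refine Metric.infDist_le_infDist_of_subset (fun z hz hzk => ?_) ⟨y, hsub hy⟩
  rw [(isOpen_iUnion hS).frontier_eq] at hz
  exact hz.2 (mem_iUnion.2 ⟨k, hzk⟩)

theorem innerTube_iUnion {S : ℕ → Set E} (hS : ∀ k, IsOpen (S k))
    (hd : Pairwise fun k l => Disjoint (S k) (S l)) (hne : ∀ k, S k ≠ univ) (ε : ℝ) :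
    innerTube (⋃ k, S k) ε = ⋃ k, innerTube (S k) ε := by
  ext x
  simp only [innerTube, mem_ofPred_eq, mem_iUnion]
  constructor
  · rintro ⟨⟨k, hk⟩, h⟩
    exact ⟨k, hk, infDist_frontier_iUnion hS hd hne hk ▸ h⟩
  · rintro ⟨k, hk, h⟩
    exact ⟨⟨k, hk⟩, (infDist_frontier_iUnion hS hd hne hk).symm ▸ h⟩

theorem list_map_prod_pos {J : ℕ} {r : Fin J → ℝ} (hr : ∀ j, 0 < r j) (w : List (Fin J)) :
    0 < (w.map r).prod :=
  List.prod_pos fun _ ha => by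
    obtain ⟨j, _, rfl⟩ := List.mem_map.1 ha
    exact hr j

/-- The inner tube volume of a self-similar spray is the sum of those of its members. -/
theorem volume_innerTube_spray (hn : n ≠ 0) {J : ℕ} {r : Fin J → ℝ} (hr : ∀ j, 0 < r j)
    {G : Set E} (hG : IsOpen G) (hvol : volume G ≠ ⊤) {S : ℕ → Set E}
    (hS : IsSelfSimilarSpray r G S) (ε : ℝ) :
    volume (innerTube (⋃ k, S k) ε) = ∑' w : List (Fin J),
      ENNReal.ofReal ((w.map r).prod ^ n) * volume (innerTube G (ε / (w.map r).prod)) := by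
  obtain ⟨⟨w, hw⟩, hd⟩ := hS
  have hpos := list_map_prod_pos hr
  have hopen k : IsOpen (S k) := (hw k).isOpen (hpos _) hG
  have hne k : S k ≠ univ := ne_univ_of_volume_ne_top hn <| by
    rw [(hw k).volume_eq (hpos _)]
    exact ENNReal.mul_ne_top ENNReal.ofReal_ne_top hvol
  rw [innerTube_iUnion hopen hd hne, measure_iUnion
    (fun k l hkl => (hd hkl).mono (fun x hx => hx.1) fun x hx => hx.1)
    fun k => (isOpen_innerTube (hopen k) ε).measurableSet, ← w.tsum_eq]
  exact tsum_congr fun k => (hw k).volume_innerTube (hpos _) ε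

/-- The inner tube volume is left continuous in the size of the tube. -/
theorem tendsto_innerTubeVolume_left {G : Set E} (hvol : volume G ≠ ⊤) (g : ℝ) :
    Filter.Tendsto (innerTubeVolume G) (𝓝[<] g) (𝓝 (innerTubeVolume G g)) := by
  have hmono : Monotone (innerTube G) := fun a b hab x hx => ⟨hx.1, hx.2.trans_le hab⟩
  have hfin (ε : ℝ) : volume (innerTube G ε) ≠ ⊤ :=
    ne_top_of_le_ne_top hvol (measure_mono fun x hx => hx.1)
  have hm : Monotone (innerTubeVolume G) := fun a b hab =>
    ENNReal.toReal_mono (hfin b) (measure_mono (hmono hab))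
  obtain ⟨u, hu, hug, hut⟩ := exists_seq_strictMono_tendsto g
  -- The strict inequality in `innerTube` is what makes the smaller tubes exhaust the tube of size
  -- `g`.
  have hU : ⋃ k, innerTube G (u k) = innerTube G g := by
    ext x
    simp only [mem_iUnion]
    constructor
    · rintro ⟨k, hk⟩
      exact hmono (hug k).le hk
    · rintro ⟨hx, hx'⟩
      obtain ⟨k, hk⟩ := (hut.eventually (eventually_gt_nhds hx')).exists
      exact ⟨k, hx, hk⟩
  have ht : Filter.Tendsto (fun k => innerTubeVolume G (u k)) Filter.atTop
      (𝓝 (innerTubeVolume G g)) := by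
    refine (ENNReal.tendsto_toReal (hfin g)).comp ?_
    rw [← hU]
    exact tendsto_measure_iUnion_atTop fun a b hab => hmono (hu.monotone hab)
  have hs := hm.tendsto_nhdsLT g
  have hu' : Filter.Tendsto u Filter.atTop (𝓝[<] g) :=
    tendsto_nhdsWithin_iff.2 ⟨hut, Filter.Eventually.of_forall hug⟩
  rwa [tendsto_nhds_unique (hs.comp hu') ht] at hs

end Similarity

end SelfSimilarSpray

/-! ### Sums over words, Mellin inversion and the line integral. -/

namespace SelfSimilarSpray

open Set MeasureTheory

section Words

theorem sum_tuple_prod {J : ℕ} {R : Type*} [CommSemiring R] (a : Fin J → R) (l : ℕ) :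
    ∑ f : Fin l → Fin J, ((List.ofFn f).map a).prod = (∑ j, a j) ^ l := by
  simp only [List.map_ofFn, List.prod_ofFn, Function.comp_def]
  rw [← Fin.prod_const, Finset.prod_univ_sum, Fintype.piFinset_univ]

/-- Grouped by length, the words of length `l` contribute `(∑ b_j)^l`, a geometric series. -/
theorem summable_word_prod {J : ℕ} {b : Fin J → ℝ} (hb : ∀ j, 0 ≤ b j) (h1 : ∑ j, b j < 1) :
    Summable fun w : List (Fin J) => (w.map b).prod := by
  rw [← List.equivSigmaTuple.symm.summable_iff]
  have h0 (w : List (Fin J)) : 0 ≤ (w.map b).prod := List.prod_nonneg fun _ ha => by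
    obtain ⟨j, _, rfl⟩ := List.mem_map.1 ha
    exact hb j
  refine (summable_sigma_of_nonneg fun _ => h0 _).2 ⟨fun l => Summable.of_finite, ?_⟩
  refine (summable_geometric_of_lt_one (Finset.sum_nonneg fun j _ => hb j) h1).congr fun l => ?_
  rw [tsum_fintype, ← sum_tuple_prod b l]
  rfl

/-- The sum over all finite words of the products of their letters. -/
theorem hasSum_word_prod {J : ℕ} {a : Fin J → ℂ} (h1 : ∑ j, ‖a j‖ < 1) :
    HasSum (fun w : List (Fin J) => (w.map a).prod) (1 - ∑ j, a j)⁻¹ := by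
  have hs : Summable fun w : List (Fin J) => (w.map a).prod := by
    refine Summable.of_norm ((summable_word_prod (fun j => norm_nonneg (a j)) h1).congr fun w => ?_)
    rw [List.norm_prod, List.map_map]
    rfl
  have hs' := List.equivSigmaTuple.symm.summable_iff.2 hs
  refine hs.hasSum_iff.2 ?_
  rw [← List.equivSigmaTuple.symm.tsum_eq]
  refine hs'.tsum_sigma.trans ?_
  rw [← tsum_geometric_of_norm_lt_one ((norm_sum_le _ _).trans_lt h1)]
  refine tsum_congr fun l => ?_
  rw [tsum_fintype, ← sum_tuple_prod a l]
  rfl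

theorem word_prod_cpow {J : ℕ} {r : Fin J → ℝ} (hr : ∀ j, 0 < r j) (s : ℂ) (w : List (Fin J)) :
    (((w.map r).prod : ℝ) : ℂ) ^ s = (w.map fun j => (r j : ℂ) ^ s).prod := by
  induction w with
  | nil => simp
  | cons j w ih =>
    rw [List.map_cons, List.prod_cons, List.map_cons, List.prod_cons, Complex.ofReal_mul,
      Complex.mul_cpow_ofReal_nonneg (hr j).le (list_map_prod_pos hr w).le, ih]

end Words

section Mellin

/-- The function `∑_{i≤n} κ_i g^(s-i)/(s-i)` of `s`. -/
noncomputable def tubeNumerator (n : ℕ) (κ : ℕ → ℝ) (g : ℝ) (s : ℂ) : ℂ :=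
  ∑ i ∈ Finset.range (n + 1), (κ i : ℂ) * ((g : ℂ) ^ (s - (i : ℂ)) / (s - (i : ℂ)))

/-- The polynomial `∑_{i<n} κ_i x^(n-i)`, frozen from `x = g` on. -/
def monophaseTube (n : ℕ) (κ : ℕ → ℝ) (g x : ℝ) : ℝ :=
  ∑ i ∈ Finset.range n, κ i * min x g ^ (n - i)

variable {n : ℕ} {κ : ℕ → ℝ} {g : ℝ}

theorem continuous_monophaseTube : Continuous (monophaseTube n κ g) := by
  unfold monophaseTube
  fun_prop

theorem tubeNumerator_eq (hg : 0 < g) (s : ℂ) : tubeNumerator n κ g s =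
    (g : ℂ) ^ s * ∑ i ∈ Finset.range (n + 1), ((κ i / g ^ i : ℝ) : ℂ) / (s - (i : ℂ)) := by
  unfold tubeNumerator
  rw [Finset.mul_sum]
  refine Finset.sum_congr rfl fun i _ => ?_
  rw [Complex.cpow_sub _ _ (by exact_mod_cast hg.ne'), Complex.cpow_natCast]
  push_cast
  ring

/-- The cancellation `∑ κ_i g^(-i) = 0` makes the numerator decay quadratically. -/
theorem norm_tubeNumerator_le (hg : 0 < g)
    (h0 : ∑ i ∈ Finset.range (n + 1), κ i / g ^ i = 0) {d : ℝ} (hd : 0 < d) :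
    ∃ C, 0 ≤ C ∧ ∀ s : ℂ, (∀ i ≤ n, d ≤ ‖s - (i : ℂ)‖) →
      ‖tubeNumerator n κ g s‖ ≤ g ^ s.re * (C / ‖s‖ ^ 2) := by
  refine ⟨∑ i ∈ Finset.range (n + 1), |κ i / g ^ i| * i * (1 + n / d),
    Finset.sum_nonneg fun i _ => by positivity, fun s hs => ?_⟩
  have hs0 : d ≤ ‖s‖ := by simpa using hs 0 (Nat.zero_le _)
  have hs0' : s ≠ 0 := norm_pos_iff.1 (hd.trans_le hs0)
  rw [tubeNumerator_eq hg, norm_mul, Complex.norm_cpow_eq_rpow_re_of_pos hg]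
  refine mul_le_mul_of_nonneg_left ?_ (Real.rpow_nonneg hg.le _)
  -- Subtracting `∑ κ_i g^(-i) / s = 0` termwise uses `1/(s-i) - 1/s = i/(s(s-i))`.
  have e : ∑ i ∈ Finset.range (n + 1), ((κ i / g ^ i : ℝ) : ℂ) / (s - (i : ℂ)) =
      ∑ i ∈ Finset.range (n + 1), ((κ i / g ^ i : ℝ) : ℂ) * i / (s * (s - (i : ℂ))) := by
    have h0' : ∑ i ∈ Finset.range (n + 1), ((κ i / g ^ i : ℝ) : ℂ) / s = 0 := by
      rw [← Finset.sum_div, ← Complex.ofReal_sum, h0]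
      simp
    rw [← sub_zero (∑ i ∈ Finset.range (n + 1), ((κ i / g ^ i : ℝ) : ℂ) / (s - (i : ℂ))), ← h0',
      ← Finset.sum_sub_distrib]
    refine Finset.sum_congr rfl fun i hi => ?_
    have : s - i ≠ 0 := norm_pos_iff.1 (hd.trans_le (hs i (by simpa [Nat.lt_succ_iff] using hi)))
    field_simp
    ring
  rw [e, Finset.sum_div]
  refine (norm_sum_le _ _).trans (Finset.sum_le_sum fun i hi => ?_)
  have hin : i ≤ n := by simpa [Nat.lt_succ_iff] using hi
  have hsi := hs i hin
  have hsi0 : 0 < ‖s - i‖ := hd.trans_le hsi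
  have hle : ‖s‖ ≤ (1 + n / d) * ‖s - i‖ := by
    have h1 : ‖s‖ ≤ ‖s - i‖ + n := by
      calc ‖s‖ = ‖(s - i) + i‖ := by ring_nf
        _ ≤ ‖s - i‖ + ‖(i : ℂ)‖ := norm_add_le _ _
        _ ≤ ‖s - i‖ + n := by
          rw [Complex.norm_natCast]
          gcongr
    have h2 : (n : ℝ) ≤ n / d * ‖s - i‖ := by
      rw [div_mul_eq_mul_div, le_div_iff₀ hd]
      gcongr
    linarith
  rw [norm_div, norm_mul, norm_mul, Complex.norm_real, Complex.norm_natCast, Real.norm_eq_abs,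
    div_le_div_iff₀ (by positivity) (by positivity)]
  calc |κ i / g ^ i| * i * ‖s‖ ^ 2 = (|κ i / g ^ i| * i * ‖s‖) * ‖s‖ := by ring
    _ ≤ (|κ i / g ^ i| * i * ‖s‖) * ((1 + n / d) * ‖s - i‖) := by gcongr
    _ = _ := by ring

theorem continuous_tubeNumerator_vertical (hg : 0 < g) {c : ℝ} (hc : ∀ i ≤ n, c ≠ i) :
    Continuous fun t : ℝ => tubeNumerator n κ g (c + t * Complex.I) := by
  refine continuous_finsetSum _ fun i hi => continuous_const.mul (Continuous.div ?_ ?_ fun t h => ?_)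
  · exact Continuous.const_cpow (by fun_prop) (Or.inl (by exact_mod_cast hg.ne'))
  · fun_prop
  · have := congrArg Complex.re h
    simp at this
    exact hc i (by simpa [Nat.lt_succ_iff] using hi) (by linarith)

theorem integrable_tubeNumerator_vertical (hg : 0 < g)
    (h0 : ∑ i ∈ Finset.range (n + 1), κ i / g ^ i = 0) {c : ℝ} (hc0 : 0 < c)
    (hc : (n : ℝ) - 1 < c) (hcn : c < n) :
    Integrable fun t : ℝ => tubeNumerator n κ g (c + t * Complex.I) := by
  -- This is the distance from the line `Re s = c` to the poles, among which `n-1` and `n` have the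
  -- nearest real parts.
  have hd : 0 < min (c - (n - 1)) (n - c) := lt_min (by linarith) (by linarith)
  have hci : ∀ i ≤ n, min (c - (n - 1)) (n - c) ≤ |c - i| := by
    intro i hi
    rcases hi.eq_or_lt with rfl | hi
    · refine (min_le_right _ _).trans ?_
      rw [abs_sub_comm]
      exact le_abs_self _
    · refine (min_le_left _ _).trans (le_trans ?_ (le_abs_self _))
      have : (i : ℝ) + 1 ≤ n := by exact_mod_cast hi
      linarith
  obtain ⟨C, hC, hN⟩ := norm_tubeNumerator_le hg h0 hd
  refine Integrable.mono' (integrable_inv_one_add_sq.const_mul (g ^ c * (C / min (c ^ 2) 1)))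
    (continuous_tubeNumerator_vertical hg fun i hi h => ?_).aestronglyMeasurable
    (Filter.Eventually.of_forall fun t => ?_)
  · have := hci i hi
    rw [h, sub_self, abs_zero] at this
    rw [h] at hd
    exact absurd this hd.not_ge
  · refine (hN _ fun i hi => (hci i hi).trans ?_).trans ?_
    · refine le_trans (le_of_eq ?_) (Complex.abs_re_le_norm _)
      simp
    · have e1 : (c + t * Complex.I : ℂ).re = c := by simp
      have e2 : ‖(c + t * Complex.I : ℂ)‖ ^ 2 = c ^ 2 + t ^ 2 := by
        rw [← Complex.normSq_eq_norm_sq, Complex.normSq_apply]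
        simp
        ring
      rw [e1, e2, mul_assoc]
      refine mul_le_mul_of_nonneg_left ?_ (Real.rpow_nonneg hg.le _)
      have hm : 0 < min (c ^ 2) 1 := lt_min (by positivity) one_pos
      rw [← div_eq_mul_inv, div_div]
      refine div_le_div_of_nonneg_left hC (by positivity) ?_
      have h1 : min (c ^ 2) 1 ≤ c ^ 2 := min_le_left _ _
      have h2 : min (c ^ 2) 1 * t ^ 2 ≤ 1 * t ^ 2 :=
        mul_le_mul_of_nonneg_right (min_le_right _ _) (sq_nonneg t)
      linarith

/-- The Mellin transform of the tube function of a monophase generator. -/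
theorem hasMellin_monophaseTube (hg : 0 < g)
    (hgn : ∑ i ∈ Finset.range n, κ i * g ^ (n - i) = -κ n) {s : ℂ}
    (hs : (n : ℝ) - 1 < s.re) (hsn : s.re < n) :
    HasMellin (fun x : ℝ => ((monophaseTube n κ g x / x ^ n : ℝ) : ℂ)) s (tubeNumerator n κ g s) := by
  have e1 : EqOn (fun x : ℝ => (x : ℂ) ^ (s - 1) • ((monophaseTube n κ g x / x ^ n : ℝ) : ℂ))
      (fun x : ℝ => ∑ i ∈ Finset.range n, (κ i : ℂ) * (x : ℂ) ^ (s - i - 1)) (Ioc 0 g) := by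
    intro x hx
    have hx0 : (x : ℂ) ≠ 0 := by exact_mod_cast hx.1.ne'
    simp only [monophaseTube, min_eq_left hx.2, smul_eq_mul, Finset.sum_div, Complex.ofReal_sum,
      Finset.mul_sum]
    refine Finset.sum_congr rfl fun i hi => ?_
    rw [show s - i - 1 = (s - 1) - i by ring, Complex.cpow_sub (s - 1) _ hx0, Complex.cpow_natCast]
    have : (x : ℂ) ^ n = x ^ (n - i) * x ^ i := by
      rw [← pow_add, Nat.sub_add_cancel (Finset.mem_range.1 hi).le]
    push_cast
    rw [this]
    field_simp
  -- Beyond `g` the tube function is frozen at `-κ n`. This tail supplies the term `i = n` of the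
  -- numerator and converges only for `Re s < n`, as the part near `0` needs `Re s > n-1`.
  have e2 : EqOn (fun x : ℝ => (x : ℂ) ^ (s - 1) • ((monophaseTube n κ g x / x ^ n : ℝ) : ℂ))
      (fun x : ℝ => -(κ n : ℂ) * (x : ℂ) ^ (s - n - 1)) (Ioi g) := by
    intro x hx
    have hx0 : (x : ℂ) ≠ 0 := by exact_mod_cast (hg.trans hx).ne'
    simp only [monophaseTube, min_eq_right (mem_Ioi.1 hx).le, smul_eq_mul, hgn]
    rw [show s - n - 1 = (s - 1) - n by ring, Complex.cpow_sub (s - 1) _ hx0, Complex.cpow_natCast]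
    push_cast
    field_simp
  have hre : ∀ i ∈ Finset.range n, -1 < (s - i - 1).re := by
    intro i hi
    have : (i : ℝ) + 1 ≤ n := by exact_mod_cast Finset.mem_range.1 hi
    simp
    linarith
  have hren : (s - n - 1).re < -1 := by
    simp
    linarith
  have i0 : ∀ i ∈ Finset.range n,
      IntegrableOn (fun x : ℝ => (κ i : ℂ) * (x : ℂ) ^ (s - i - 1)) (Ioc 0 g) := fun i hi =>
    ((intervalIntegrable_iff_integrableOn_Ioc_of_le hg.le).1
      (intervalIntegral.intervalIntegrable_cpow' (hre i hi))).const_mul _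
  have i1 : IntegrableOn
      (fun x : ℝ => (x : ℂ) ^ (s - 1) • ((monophaseTube n κ g x / x ^ n : ℝ) : ℂ)) (Ioc 0 g) :=
    IntegrableOn.congr_fun (integrable_finsetSum _ i0) e1.symm measurableSet_Ioc
  have i2 : IntegrableOn
      (fun x : ℝ => (x : ℂ) ^ (s - 1) • ((monophaseTube n κ g x / x ^ n : ℝ) : ℂ)) (Ioi g) :=
    IntegrableOn.congr_fun ((integrableOn_Ioi_cpow_of_lt hren hg).const_mul _) e2.symm
      measurableSet_Ioi
  refine ⟨?_, ?_⟩
  · rw [MellinConvergent, ← Ioc_union_Ioi_eq_Ioi hg.le]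
    exact i1.union i2
  · rw [mellin, ← Ioc_union_Ioi_eq_Ioi hg.le, setIntegral_union
      (disjoint_left.2 fun x hx hx' => hx.2.not_gt hx') measurableSet_Ioi i1 i2,
      setIntegral_congr_fun measurableSet_Ioc e1, setIntegral_congr_fun measurableSet_Ioi e2,
      integral_finsetSum _ i0, integral_const_mul, integral_Ioi_cpow_of_lt hren hg, tubeNumerator,
      Finset.sum_range_succ]
    congr 1
    · refine Finset.sum_congr rfl fun i hi => ?_
      rw [integral_const_mul, ← intervalIntegral.integral_of_le hg.le,
        integral_cpow (Or.inl (hre i hi)), sub_add_cancel, Complex.ofReal_zero,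
        Complex.zero_cpow, sub_zero]
      intro h
      have := hre i hi
      rw [Complex.sub_re, h] at this
      simp at this
    · rw [sub_add_cancel]
      ring

/-- The tube function of a monophase generator as an inverse Mellin transform. -/
theorem integral_tubeNumerator_eq (hg : 0 < g)
    (hgn : ∑ i ∈ Finset.range n, κ i * g ^ (n - i) = -κ n)
    (h0 : ∑ i ∈ Finset.range (n + 1), κ i / g ^ i = 0) {c : ℝ} (hc0 : 0 < c)
    (hc : (n : ℝ) - 1 < c) (hcn : c < n) {x : ℝ} (hx : 0 < x) :
    (1 / (2 * Real.pi) : ℝ) • ∫ t : ℝ, (x : ℂ) ^ (-(c + t * Complex.I)) •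
      tubeNumerator n κ g (c + t * Complex.I) = ((monophaseTube n κ g x / x ^ n : ℝ) : ℂ) := by
  have hM : ∀ t : ℝ, mellin (fun x : ℝ => ((monophaseTube n κ g x / x ^ n : ℝ) : ℂ))
      (c + t * Complex.I) = tubeNumerator n κ g (c + t * Complex.I) := fun t =>
    (hasMellin_monophaseTube hg hgn (by simpa using hc) (by simpa using hcn)).2
  rw [← mellinInv_mellin_eq c (fun x : ℝ => ((monophaseTube n κ g x / x ^ n : ℝ) : ℂ)) hx
    (hasMellin_monophaseTube hg hgn (by simpa using hc) (by simpa using hcn)).1]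
  · simp only [mellinInv, hM]
  · simp only [Complex.VerticalIntegrable, hM]
    exact integrable_tubeNumerator_vertical hg h0 hc0 hc hcn
  · exact Complex.continuous_ofReal.continuousAt.comp
      (continuous_monophaseTube.continuousAt.div (by fun_prop) (pow_ne_zero _ hx.ne'))

end Mellin

section Spray

theorem sum_norm_cpow {J : ℕ} {r : Fin J → ℝ} (hr : ∀ j, 0 < r j) (s : ℂ) :
    ∑ j, ‖(r j : ℂ) ^ s‖ = ∑ j, r j ^ s.re :=
  Finset.sum_congr rfl fun j _ => Complex.norm_cpow_eq_rpow_re_of_pos (hr j) _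

theorem tubeIntegrand_eq (n : ℕ) {J : ℕ} (r : Fin J → ℝ) (κ : ℕ → ℝ) (g ε : ℝ) (s : ℂ) :
    tubeIntegrand n r κ g ε s =
      (ε : ℂ) ^ ((n : ℂ) - s) * (tubeNumerator n κ g s / (1 - ∑ j, (r j : ℂ) ^ s)) := rfl

variable {n J : ℕ} {κ : ℕ → ℝ} {g : ℝ} {r : Fin J → ℝ}

/-- On the line the denominator is at least `1 - ∑ r_j^c > 0` in modulus, so the integrand is the
integrable numerator times a bounded factor. -/
theorem integrable_tubeIntegrand_vertical (hr : ∀ j, 0 < r j) (hg : 0 < g)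
    (h0 : ∑ i ∈ Finset.range (n + 1), κ i / g ^ i = 0) {c : ℝ} (hc0 : 0 < c)
    (hc : (n : ℝ) - 1 < c) (hcn : c < n) (hrc : ∑ j, r j ^ c < 1) {ε : ℝ} (hε : 0 < ε) :
    Integrable fun t : ℝ => tubeIntegrand n r κ g ε (c + t * Complex.I) := by
  have hden (t : ℝ) : 1 - ∑ j, r j ^ c ≤ ‖1 - ∑ j, (r j : ℂ) ^ (c + t * Complex.I : ℂ)‖ := by
    refine le_trans ?_ (norm_sub_norm_le _ _)
    rw [norm_one]
    refine sub_le_sub_left ((norm_sum_le _ _).trans (le_of_eq ?_)) _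
    rw [sum_norm_cpow hr]
    simp
  have hpos : 0 < 1 - ∑ j, r j ^ c := by linarith
  simp only [tubeIntegrand_eq, mul_div_assoc', mul_comm _ (tubeNumerator _ _ _ _)]
  simp only [mul_div_assoc]
  refine (integrable_tubeNumerator_vertical hg h0 hc0 hc hcn).mul_bdd
    (c := ε ^ (n - c) / (1 - ∑ j, r j ^ c)) ?_ (Filter.Eventually.of_forall fun t => ?_)
  · refine (Continuous.div ?_ ?_ fun t => norm_pos_iff.1 (hpos.trans_le (hden t))).aestronglyMeasurable
    · exact Continuous.const_cpow (by fun_prop) (Or.inl (by exact_mod_cast hε.ne'))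
    · refine continuous_const.sub (continuous_finsetSum _ fun j _ => ?_)
      exact Continuous.const_cpow (by fun_prop) (Or.inl (by exact_mod_cast (hr j).ne'))
  · rw [norm_div, Complex.norm_cpow_eq_rpow_re_of_pos hε]
    simp only [Complex.sub_re, Complex.natCast_re, Complex.add_re, Complex.ofReal_re,
      Complex.mul_re, Complex.I_re, mul_zero, Complex.ofReal_im, Complex.I_im, mul_one, sub_self,
      add_zero]
    exact div_le_div_of_nonneg_left (Real.rpow_nonneg hε.le _) hpos (hden t)

/-- The sum of the tube functions of the scaled copies as a vertical line integral. -/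
theorem hasSum_monophaseTube (hr : ∀ j, 0 < r j) (hg : 0 < g)
    (hgn : ∑ i ∈ Finset.range n, κ i * g ^ (n - i) = -κ n)
    (h0 : ∑ i ∈ Finset.range (n + 1), κ i / g ^ i = 0) {c : ℝ} (hc0 : 0 < c)
    (hc : (n : ℝ) - 1 < c) (hcn : c < n) (hrc : ∑ j, r j ^ c < 1) {ε : ℝ} (hε : 0 < ε) :
    HasSum (fun w : List (Fin J) =>
        (((w.map r).prod ^ n * monophaseTube n κ g (ε / (w.map r).prod) : ℝ) : ℂ))
      ((1 / (2 * Real.pi) : ℝ) • ∫ t : ℝ, tubeIntegrand n r κ g ε (c + t * Complex.I)) := by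
  have hpos := list_map_prod_pos hr
  have hεC : (ε : ℂ) ≠ 0 := by exact_mod_cast hε.ne'
  -- `F w` is the term of the word `w` when `1/(1 - ∑ r_j^s)` is expanded as a series over words.
  set F : List (Fin J) → ℝ → ℂ := fun w t => (ε : ℂ) ^ ((n : ℂ) - (c + t * Complex.I)) *
    tubeNumerator n κ g (c + t * Complex.I) *
    (((w.map r).prod : ℝ) : ℂ) ^ (c + t * Complex.I : ℂ) with hF
  have hnorm (w : List (Fin J)) (t : ℝ) : ‖F w t‖ =
      ε ^ (n - c) * ‖tubeNumerator n κ g (c + t * Complex.I)‖ * (w.map fun j => r j ^ c).prod := by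
    simp only [hF]
    rw [norm_mul, norm_mul, Complex.norm_cpow_eq_rpow_re_of_pos hε, word_prod_cpow hr,
      List.norm_prod, List.map_map]
    congr 2
    · simp
    · congr 1
      funext j
      simp [Complex.norm_cpow_eq_rpow_re_of_pos (hr j)]
  have hFint (w : List (Fin J)) : Integrable (F w) := by
    refine Integrable.mono' (((integrable_tubeNumerator_vertical hg h0 hc0 hc hcn).norm.const_mul
      (ε ^ (n - c))).mul_const (w.map fun j => r j ^ c).prod) ?_
      (Filter.Eventually.of_forall fun t => (hnorm w t).le)
    refine Continuous.aestronglyMeasurable ((Continuous.mul ?_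
      (continuous_tubeNumerator_vertical hg fun i hi h => ?_)).mul ?_)
    · exact Continuous.const_cpow (by fun_prop) (Or.inl hεC)
    · subst h
      have h1 : i < n := by exact_mod_cast hcn
      have h2 : n < i + 1 := by
        have : (n : ℝ) < i + 1 := by linarith
        exact_mod_cast this
      omega
    · exact Continuous.const_cpow (by fun_prop) (Or.inl (by exact_mod_cast (hpos w).ne'))
  -- On the line `|λ_w^s| = λ_w^c` does not depend on `t`, and these numbers are summable; this
  -- justifies exchanging sum and integral.
  have hFsum : Summable fun w => ∫ t, ‖F w t‖ := by
    simp only [hnorm, integral_mul_const]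
    exact (summable_word_prod (fun j => Real.rpow_nonneg (hr j).le _) hrc).mul_left _
  have hts : ∀ t : ℝ, ∑' w, F w t = tubeIntegrand n r κ g ε (c + t * Complex.I) := by
    intro t
    have := hasSum_word_prod (a := fun j => (r j : ℂ) ^ (c + t * Complex.I : ℂ))
      (by rw [sum_norm_cpow hr]; simpa using hrc)
    simp only [hF, word_prod_cpow hr]
    rw [tsum_mul_left, this.tsum_eq, tubeIntegrand_eq]
    ring
  have key := (hasSum_integral_of_summable_integral_norm hFint hFsum).const_smul
    (1 / (2 * Real.pi) : ℝ)
  simp only [hts] at key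
  refine key.congr_fun fun w => ?_
  set l := (w.map r).prod with hl
  have hl0 : 0 < l := hpos w
  have hx := integral_tubeNumerator_eq hg hgn h0 hc0 hc hcn (div_pos hε hl0)
  -- With `l = λ_w`, the identity `ε^(n-s) l^s = ε^n (ε/l)^(-s)` turns the term into Mellin
  -- inversion at `x = ε/l`.
  have e : F w = fun t : ℝ => (ε : ℂ) ^ n * (((ε / l : ℝ) : ℂ) ^ (-(c + t * Complex.I)) •
      tubeNumerator n κ g (c + t * Complex.I)) := by
    funext t
    simp only [hF, ← hl]
    rw [Complex.cpow_sub _ _ hεC, Complex.cpow_natCast, Complex.ofReal_div, 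
      Complex.cpow_neg, smul_eq_mul]
    have : ((ε : ℂ) / l) ^ (c + t * Complex.I : ℂ) =
        (ε : ℂ) ^ (c + t * Complex.I : ℂ) / (l : ℂ) ^ (c + t * Complex.I : ℂ) := 
      Complex.div_cpow_ofReal_nonneg hε.le hl0.le _
    rw [this, inv_div]
    ring
  rw [e, integral_const_mul, ← mul_smul_comm, hx]
  have hlC : (l : ℂ) ≠ 0 := by exact_mod_cast hl0.ne'
  have hmul : (l : ℂ) * (ε / l) = ε := mul_div_cancel₀ _ hlC
  push_cast
  field_simp
  rw [mul_right_comm, ← mul_pow, hmul, mul_comm]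

end Spray

end SelfSimilarSpray

/-! ### Zeros and lower bounds of the denominator. -/

namespace SelfSimilarSpray

open Set Filter

/-- The exponential polynomial `1 - ∑_j a_j r_j^s`. -/
noncomputable def expPoly {J : ℕ} (a : Fin J → ℂ) (r : Fin J → ℝ) (s : ℂ) : ℂ :=
  1 - ∑ j, a j * (r j : ℂ) ^ s

/-- Infinitely many zeros would accumulate in `K`, and the identity theorem would force `F = 0`. -/
theorem finite_zeros_of_isCompact {F : ℂ → ℂ} (hF : Differentiable ℂ F) {s₀ : ℂ} (h0 : F s₀ ≠ 0)
    {K : Set ℂ} (hK : IsCompact K) : {s ∈ K | F s = 0}.Finite := by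
  by_contra hinf
  obtain ⟨x, _, hx⟩ := Set.Infinite.exists_accPt_of_subset_isCompact hinf hK fun s hs => hs.1
  have hfr : ∃ᶠ s in 𝓝[≠] x, F s = 0 :=
    (accPt_iff_frequently_nhdsNE.1 hx).mono fun s hs => hs.2
  have han : AnalyticOnNhd ℂ F univ := fun s _ => hF.analyticAt s
  exact h0 (han.eqOn_zero_of_preconnected_of_frequently_eq_zero isPreconnected_univ
    (mem_univ x) hfr (mem_univ s₀))

section

variable {J : ℕ} {r : Fin J → ℝ}

theorem differentiable_expPoly (hr : ∀ j, 0 < r j) (a : Fin J → ℂ) :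
    Differentiable ℂ (expPoly a r) := by
  refine (differentiable_const _).sub (Differentiable.fun_sum fun j _ => ?_)
  exact (Differentiable.const_cpow differentiable_id
    (Or.inl (by exact_mod_cast (hr j).ne'))).const_mul _

theorem expPoly_one (s : ℂ) : expPoly 1 r s = 1 - ∑ j, (r j : ℂ) ^ s := by
  simp [expPoly]

/-- Coefficients of modulus at most one are allowed so that the limit of vertical translates in
`exists_horizontal_lines` is covered. -/
theorem expPoly_ne_zero (hr : ∀ j, 0 < r j) {a : Fin J → ℂ} (ha : ∀ j, ‖a j‖ ≤ 1) {s : ℂ}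
    (hs : ∑ j, r j ^ s.re < 1) : expPoly a r s ≠ 0 := by
  intro h
  have h1 : (1 : ℝ) ≤ ∑ j, r j ^ s.re := by
    rw [← norm_one (α := ℂ), sub_eq_zero.1 h]
    refine (norm_sum_le _ _).trans (Finset.sum_le_sum fun j _ => ?_)
    rw [norm_mul, Complex.norm_cpow_eq_rpow_re_of_pos (hr j)]
    exact mul_le_of_le_one_left (Real.rpow_nonneg (hr j).le _) (ha j)
  exact h1.not_gt hs

theorem sum_rpow_lt_one (hr : ∀ j, 0 < r j ∧ r j < 1) {D : ℝ} (hD : ∑ j, r j ^ D = 1) {c : ℝ}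
    (hc : D < c) : ∑ j, r j ^ c < 1 := by
  have hne : (Finset.univ : Finset (Fin J)).Nonempty := by
    by_contra h
    rw [Finset.not_nonempty_iff_eq_empty.1 h] at hD
    simp at hD
  rw [← hD]
  exact Finset.sum_lt_sum_of_nonempty hne fun j _ =>
    Real.rpow_lt_rpow_of_exponent_gt (hr j).1 (hr j).2 hc

/-- Far to the left the smallest ratio dominates. -/
theorem exists_one_le_norm_expPoly_left (hr : ∀ j, 0 < r j ∧ r j < 1) (hJ : 0 < J) :
    ∃ σ₀ ≤ (0 : ℝ), ∀ s : ℂ, s.re ≤ σ₀ → 1 ≤ ‖expPoly 1 r s‖ := by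
  classical
  have : Nonempty (Fin J) := ⟨⟨0, hJ⟩⟩
  obtain ⟨j₀, hj₀⟩ := Finite.exists_min r
  have hρ := hr j₀
  -- The smallest ratio may be repeated; its equal terms add up without cancellation, so only the
  -- indices outside `A` compete with it.
  set A := Finset.univ.filter fun j => r j = r j₀ with hA
  -- The constant `2` leaves a margin of `1` after the term `1` of the exponential polynomial is
  -- absorbed.
  have hlim : Tendsto (fun σ : ℝ => 2 * (r j₀)⁻¹ ^ σ + ∑ j ∈ Aᶜ, (r j / r j₀) ^ σ) atBot
      (𝓝 (2 * 0 + ∑ j ∈ Aᶜ, 0)) := by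
    refine Tendsto.add ((tendsto_rpow_atBot_of_base_gt_one _
      ((one_lt_inv₀ hρ.1).2 hρ.2)).const_mul 2) (tendsto_finsetSum _ fun j hj => ?_)
    refine tendsto_rpow_atBot_of_base_gt_one _ ((one_lt_div hρ.1).2 (lt_of_le_of_ne (hj₀ j) ?_))
    intro h
    simp [hA, h] at hj
  have h01 : 2 * 0 + ∑ j ∈ Aᶜ, (0 : ℝ) < 1 := by simp
  have hev := (hlim.eventually (gt_mem_nhds h01)).and (eventually_le_atBot (0 : ℝ))
  obtain ⟨σ₀, hσ₀⟩ := eventually_atBot.1 hev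
  refine ⟨σ₀, (hσ₀ σ₀ le_rfl).2, fun s hs => ?_⟩
  have h1 := (hσ₀ s.re hs).1
  have hpos : 0 < r j₀ ^ s.re := Real.rpow_pos_of_pos hρ.1 _
  have h2 : 2 + ∑ j ∈ Aᶜ, r j ^ s.re ≤ r j₀ ^ s.re := by
    have e : (2 * (r j₀)⁻¹ ^ s.re + ∑ j ∈ Aᶜ, (r j / r j₀) ^ s.re) * r j₀ ^ s.re =
        2 + ∑ j ∈ Aᶜ, r j ^ s.re := by
      rw [add_mul, mul_assoc, Real.inv_rpow hρ.1.le, inv_mul_cancel₀ hpos.ne', mul_one,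
        Finset.sum_mul]
      congr 1
      refine Finset.sum_congr rfl fun j _ => ?_
      rw [Real.div_rpow (hr j).1.le hρ.1.le, div_mul_cancel₀ _ hpos.ne']
    rw [← e]
    exact mul_le_of_le_one_left hpos.le h1.le
  have e2 : expPoly 1 r s = (1 - ∑ j ∈ Aᶜ, (r j : ℂ) ^ s) - (A.card : ℂ) * (r j₀ : ℂ) ^ s := by
    rw [expPoly_one, ← Finset.sum_add_sum_compl A,
      Finset.sum_congr rfl fun j hj => by rw [(Finset.mem_filter.1 hj).2],
      Finset.sum_const, nsmul_eq_mul]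
    ring
  have hcard : (1 : ℝ) ≤ A.card := by
    exact_mod_cast Finset.card_pos.2 ⟨j₀, by simp [hA]⟩
  have h3 : r j₀ ^ s.re ≤ ‖(A.card : ℂ) * (r j₀ : ℂ) ^ s‖ := by
    rw [norm_mul, Complex.norm_natCast, Complex.norm_cpow_eq_rpow_re_of_pos hρ.1]
    exact le_mul_of_one_le_left hpos.le hcard
  have h4 : ‖1 - ∑ j ∈ Aᶜ, (r j : ℂ) ^ s‖ ≤ 1 + ∑ j ∈ Aᶜ, r j ^ s.re := by
    refine (norm_sub_le _ _).trans ?_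
    rw [norm_one]
    refine add_le_add le_rfl ((norm_sum_le _ _).trans (Finset.sum_le_sum fun j _ => ?_))
    rw [Complex.norm_cpow_eq_rpow_re_of_pos (hr j).1]
  rw [e2, norm_sub_rev]
  refine le_trans ?_ (norm_sub_norm_le _ _)
  linarith

theorem expPoly_one_conj (hr : ∀ j, 0 < r j) (s : ℂ) :
    expPoly 1 r (starRingEnd ℂ s) = starRingEnd ℂ (expPoly 1 r s) := by
  simp only [expPoly_one, map_sub, map_one, map_sum]
  congr 1
  refine Finset.sum_congr rfl fun j _ => ?_
  rw [Complex.cpow_conj _ _ (by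
    rw [Complex.arg_ofReal_of_nonneg (hr j).le]; exact Real.pi_pos.ne), Complex.conj_ofReal]

/-- There are arbitrarily high horizontal lines on which `1 - ∑_j r_j^s` is bounded below, by
almost periodicity. -/
theorem exists_horizontal_lines (hr : ∀ j, 0 < r j ∧ r j < 1) {D : ℝ} (hD : ∑ j, r j ^ D = 1)
    (c : ℝ) : ∃ (T : ℕ → ℝ) (δ : ℝ), StrictMono T ∧ Tendsto T atTop atTop ∧
      0 < δ ∧ ∀ m (s : ℂ), s.re ≤ c → |s.im| = T m → δ ≤ ‖expPoly 1 r s‖ := by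
  have hJ : 0 < J := by
    rcases Nat.eq_zero_or_pos J with rfl | h
    · simp at hD
    · exact h
  have hpos j := (hr j).1
  obtain ⟨σ₀, hσ₀, hleft⟩ := exists_one_le_norm_expPoly_left hr hJ
  -- Translating `expPoly 1 r` vertically by `k` multiplies its coefficients by `u k`. These lie in
  -- a compact polydisc, so the translates along a subsequence converge to some `expPoly a r`.
  set u : ℕ → Fin J → ℂ := fun k j => (r j : ℂ) ^ ((k : ℂ) * Complex.I) with hu
  have hu1 (k : ℕ) (j : Fin J) : ‖u k j‖ = 1 := by
    simp only [hu]
    rw [Complex.norm_cpow_eq_rpow_re_of_pos (hpos j)]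
    simp
  obtain ⟨a, ha, φ, hφ, hlim⟩ := (isCompact_closedBall (0 : Fin J → ℂ) 1).tendsto_subseq
    (x := u) fun k => by
      rw [mem_closedBall_zero_iff, pi_norm_le_iff_of_nonneg zero_le_one]
      exact fun j => (hu1 k j).le
  have ha1 : ∀ j, ‖a j‖ ≤ 1 := by
    rwa [mem_closedBall_zero_iff, pi_norm_le_iff_of_nonneg zero_le_one] at ha
  have hdiff := differentiable_expPoly hpos a
  have hne : expPoly a r ((D + 1 : ℝ) : ℂ) ≠ 0 :=
    expPoly_ne_zero hpos ha1 (by simpa using sum_rpow_lt_one hr hD (lt_add_one D))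
  have hfin := (finite_zeros_of_isCompact hdiff hne
    (isCompact_Icc.reProdIm isCompact_Icc : IsCompact (Icc σ₀ c ×ℂ Icc 0 1))).image Complex.im
  -- The limit function has finitely many zeros in the box, so some height `t` in `[0,1]` misses
  -- them all.
  obtain ⟨t, ht, htn⟩ := ((Icc_infinite (zero_lt_one (α := ℝ))).sdiff hfin).nonempty
  have hseg : ∃ δ > 0, ∀ σ ∈ Icc σ₀ c, δ ≤ ‖expPoly a r (σ + t * Complex.I)‖ := by
    have hcont : ContinuousOn (fun σ : ℝ => ‖expPoly a r (σ + t * Complex.I)‖) (Icc σ₀ c) := by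
      have := hdiff.continuous
      fun_prop
    rcases (Icc σ₀ c).eq_empty_or_nonempty with he | hn
    · exact ⟨1, one_pos, by simp [he]⟩
    · obtain ⟨σ, hσ, hmin⟩ := isCompact_Icc.exists_isMinOn hn hcont
      refine ⟨_, norm_pos_iff.2 fun h => htn ⟨σ + t * Complex.I, ⟨⟨?_, ?_⟩, h⟩, by simp⟩,
        fun σ' hσ' => hmin hσ'⟩
      · simpa using hσ
      · simpa using ht
  obtain ⟨δ, hδ, hseg⟩ := hseg
  -- The weight `r_j^σ₀` bounds `|r_j^s|` for `Re s ≥ σ₀`, so convergence is uniform on the segment.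
  have herr : Tendsto (fun k => ∑ j, ‖u (φ k) j - a j‖ * r j ^ σ₀) atTop (𝓝 0) := by
    have : Tendsto (fun k => ∑ j, ‖u (φ k) j - a j‖ * r j ^ σ₀) atTop
        (𝓝 (∑ j, ‖a j - a j‖ * r j ^ σ₀)) :=
      tendsto_finsetSum _ fun j _ =>
        (((tendsto_pi_nhds.1 hlim j).sub tendsto_const_nhds).norm).mul_const _
    simpa using this
  obtain ⟨K, hK⟩ := eventually_atTop.1 (herr.eventually (gt_mem_nhds (half_pos hδ)))
  refine ⟨fun m => t + φ (m + K), min 1 (δ / 2), fun m m' h => ?_, ?_,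
    lt_min one_pos (half_pos hδ), ?_⟩
  · have : φ (m + K) < φ (m' + K) := hφ (by omega)
    have : (φ (m + K) : ℝ) < φ (m' + K) := by exact_mod_cast this
    simpa using this
  · exact tendsto_atTop_add_const_left _ _ (tendsto_natCast_atTop_atTop.comp
      (hφ.tendsto_atTop.comp (tendsto_add_atTop_nat K)))
  · have key : ∀ m (s : ℂ), s.re ≤ c → s.im = t + φ (m + K) →
        min 1 (δ / 2) ≤ ‖expPoly 1 r s‖ := by
      intro m s hs him
      rcases le_total s.re σ₀ with h | h
      · exact (min_le_left _ _).trans (hleft s h)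
      · refine (min_le_right _ _).trans ?_
        have h1 := hseg s.re ⟨h, hs⟩
        have h2 : ‖expPoly a r (s.re + t * Complex.I) - expPoly 1 r s‖ ≤ δ / 2 := by
          refine le_trans ?_ (hK (m + K) (by omega)).le
          have e : expPoly a r (s.re + t * Complex.I) - expPoly 1 r s =
              ∑ j, (u (φ (m + K)) j - a j) * (r j : ℂ) ^ (s.re + t * Complex.I : ℂ) := by
            rw [expPoly_one, expPoly, sub_sub_sub_cancel_left, ← Finset.sum_sub_distrib]
            refine Finset.sum_congr rfl fun j _ => ?_
            have hs' : s = ((φ (m + K) : ℕ) : ℂ) * Complex.I + (s.re + t * Complex.I) := by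
              conv_lhs => rw [← Complex.re_add_im s, him]
              push_cast
              ring
            rw [sub_mul]
            congr 1
            conv_lhs => rw [hs']
            rw [Complex.cpow_add _ _ (by exact_mod_cast (hpos j).ne')]
          rw [e]
          refine (norm_sum_le _ _).trans (Finset.sum_le_sum fun j _ => ?_)
          rw [norm_mul, Complex.norm_cpow_eq_rpow_re_of_pos (hpos j)]
          refine mul_le_mul_of_nonneg_left ?_ (norm_nonneg _)
          simpa using Real.rpow_le_rpow_of_exponent_ge (hpos j) (hr j).2.le h
        have h3 := norm_sub_norm_le (expPoly a r (s.re + t * Complex.I)) (expPoly 1 r s)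
        linarith
    intro m s hs him
    rcases abs_choice s.im with h | h
    · exact key m s hs (h ▸ him)
    · have := key m (starRingEnd ℂ s) (by simpa using hs) (by simpa using h ▸ him)
      rwa [expPoly_one_conj hpos, RCLike.norm_conj] at this

theorem re_le_of_mem_complexDimensions (hr : ∀ j, 0 < r j ∧ r j < 1) {D : ℝ}
    (hD : ∑ j, r j ^ D = 1) {s : ℂ} (hs : s ∈ complexDimensions r) : s.re ≤ D := by
  by_contra! h
  refine expPoly_ne_zero (a := 1) (fun j => (hr j).1) (by simp) (sum_rpow_lt_one hr hD h) ?_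
  rw [expPoly_one]
  exact hs

/-- The complex dimensions lie in a vertical strip, bounded on the left by dominance of the smallest
ratio and on the right by `D`; a window therefore cuts out a compact set. -/
theorem finite_tubePoles_window (n : ℕ) (hr : ∀ j, 0 < r j ∧ r j < 1) {D : ℝ}
    (hD : ∑ j, r j ^ D = 1) (T : ℝ) : {ω ∈ tubePoles n r | |ω.im| ≤ T}.Finite := by
  have hJ : 0 < J := by
    rcases Nat.eq_zero_or_pos J with rfl | h
    · simp at hD
    · exact h
  have hpos j := (hr j).1
  obtain ⟨σ₀, _, hleft⟩ := exists_one_le_norm_expPoly_left hr hJ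
  have hne : expPoly 1 r ((D + 1 : ℝ) : ℂ) ≠ 0 :=
    expPoly_ne_zero hpos (by simp) (by simpa using sum_rpow_lt_one hr hD (lt_add_one D))
  refine ((finite_zeros_of_isCompact (differentiable_expPoly hpos 1) hne
    (isCompact_Icc.reProdIm isCompact_Icc : IsCompact (Icc σ₀ D ×ℂ Icc (-T) T))).union
    ((finite_lt_nat n).image fun i : ℕ => (i : ℂ))).subset ?_
  rintro ω ⟨hω | ⟨i, hi, rfl⟩, hT⟩
  · left
    have h0 : expPoly 1 r ω = 0 := by
      rw [expPoly_one]
      exact hω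
    refine ⟨⟨⟨?_, re_le_of_mem_complexDimensions hr hD hω⟩, abs_le.1 hT⟩, h0⟩
    by_contra! h
    have := hleft ω (le_of_lt h)
    rw [h0, norm_zero] at this
    linarith
  · right
    exact ⟨i, hi, rfl⟩

end

end SelfSimilarSpray

/-! ### Shifting the contour. -/

namespace SelfSimilarSpray

open Set Filter MeasureTheory

section Contour

variable {n J : ℕ} {κ : ℕ → ℝ} {g ε : ℝ} {r : Fin J → ℝ}

theorem tubeIntegrand_eq_expPoly (s : ℂ) : tubeIntegrand n r κ g ε s =
    (ε : ℂ) ^ ((n : ℂ) - s) * (tubeNumerator n κ g s / expPoly 1 r s) := by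
  rw [tubeIntegrand_eq, expPoly_one]

theorem analyticAt_base_cpow {b : ℝ} (hb : 0 < b) {F : ℂ → ℂ} (hF : Differentiable ℂ F) (s : ℂ) :
    AnalyticAt ℂ (fun s => (b : ℂ) ^ F s) s :=
  (hF.const_cpow (Or.inl (by exact_mod_cast hb.ne'))).analyticAt s

theorem meromorphicAt_tubeNumerator (hg : 0 < g) (s : ℂ) :
    MeromorphicAt (tubeNumerator n κ g) s := by
  refine MeromorphicAt.fun_sum fun i _ => ?_
  have h1 : AnalyticAt ℂ (fun s : ℂ => (g : ℂ) ^ (s - (i : ℂ))) s :=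
    analyticAt_base_cpow hg (differentiable_id.sub_const _) s
  have h2 : AnalyticAt ℂ (fun s : ℂ => s - (i : ℂ)) s := by fun_prop
  exact (MeromorphicAt.const (κ i : ℂ) s).fun_mul (h1.meromorphicAt.fun_div h2.meromorphicAt)

theorem differentiableAt_tubeNumerator (hg : 0 < g) {s : ℂ} (hs : ∀ i ≤ n, s ≠ (i : ℂ)) :
    DifferentiableAt ℂ (tubeNumerator n κ g) s := by
  refine DifferentiableAt.fun_sum fun i hi => ?_
  have h1 : DifferentiableAt ℂ (fun s : ℂ => (g : ℂ) ^ (s - (i : ℂ))) s :=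
    (analyticAt_base_cpow hg (differentiable_id.sub_const _) s).differentiableAt
  have h2 : DifferentiableAt ℂ (fun s : ℂ => s - (i : ℂ)) s := by fun_prop
  exact (h1.fun_div h2 (sub_ne_zero.2 (hs i (Nat.lt_succ_iff.1 (Finset.mem_range.1 hi))))).const_mul _

theorem meromorphicAt_tubeIntegrand (hr : ∀ j, 0 < r j) (hg : 0 < g) (hε : 0 < ε) (s : ℂ) :
    MeromorphicAt (tubeIntegrand n r κ g ε) s := by
  have h1 : AnalyticAt ℂ (fun s : ℂ => (ε : ℂ) ^ ((n : ℂ) - s)) s :=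
    analyticAt_base_cpow hε (differentiable_id.const_sub _) s
  have h2 : AnalyticAt ℂ (expPoly 1 r) s := (differentiable_expPoly hr 1).analyticAt s
  rw [show tubeIntegrand n r κ g ε = fun s => _ from funext tubeIntegrand_eq_expPoly]
  exact h1.meromorphicAt.fun_mul ((meromorphicAt_tubeNumerator hg s).fun_div h2.meromorphicAt)

theorem differentiableAt_tubeIntegrand (hr : ∀ j, 0 < r j) (hg : 0 < g) (hε : 0 < ε) {s : ℂ}
    (hs : s ∉ tubePoles n r) (hsn : s ≠ n) : DifferentiableAt ℂ (tubeIntegrand n r κ g ε) s := by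
  have h1 : DifferentiableAt ℂ (fun s : ℂ => (ε : ℂ) ^ ((n : ℂ) - s)) s :=
    (analyticAt_base_cpow hε (differentiable_id.const_sub _) s).differentiableAt
  have h2 : DifferentiableAt ℂ (tubeNumerator n κ g) s := by
    refine differentiableAt_tubeNumerator hg fun i hi h => ?_
    rcases hi.eq_or_lt with rfl | hi
    · exact hsn h
    · exact hs (Or.inr ⟨i, hi, h⟩)
  have h3 : expPoly 1 r s ≠ 0 := fun h => hs (Or.inl (by rwa [expPoly_one] at h))
  rw [show tubeIntegrand n r κ g ε = fun s => _ from funext tubeIntegrand_eq_expPoly]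
  exact h1.fun_mul (h2.fun_div (differentiable_expPoly hr 1 s) h3)

/-- Quadratic decay of the integrand where the denominator is bounded below. -/
theorem exists_norm_tubeIntegrand_le (hε : 0 < ε) (hεg : ε < g)
    (h0 : ∑ i ∈ Finset.range (n + 1), κ i / g ^ i = 0) (c : ℝ) {δ : ℝ} (hδ : 0 < δ) :
    ∃ B, 0 ≤ B ∧ ∀ s : ℂ, s.re ≤ c → (n : ℝ) + 1 ≤ ‖s‖ → δ ≤ ‖expPoly 1 r s‖ →
      ‖tubeIntegrand n r κ g ε s‖ ≤ B / ‖s‖ ^ 2 := by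
  have hg := hε.trans hεg
  obtain ⟨C, hC, hN⟩ := norm_tubeNumerator_le hg h0 one_pos
  refine ⟨ε ^ (n : ℝ) * (g / ε) ^ c * C / δ, by positivity, fun s hs hsn hsd => ?_⟩
  have h1 := hN s fun i hi => by
    have h := norm_sub_norm_le s (i : ℂ)
    rw [Complex.norm_natCast] at h
    have : (i : ℝ) ≤ n := by exact_mod_cast hi
    linarith
  have hs0 : 0 < ‖s‖ := lt_of_lt_of_le (by positivity) hsn
  rw [tubeIntegrand_eq_expPoly, norm_mul, norm_div, Complex.norm_cpow_eq_rpow_re_of_pos hε]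
  -- The two exponentials combine to a power of `g/ε > 1`, which is bounded for `Re s ≤ c`; this is
  -- where `ε < g` enters.
  have e : ε ^ ((n : ℂ) - s).re * g ^ s.re = ε ^ (n : ℝ) * (g / ε) ^ s.re := by
    rw [Complex.sub_re, Complex.natCast_re, Real.rpow_sub hε, Real.div_rpow hg.le hε.le]
    ring
  have h2 : (g / ε) ^ s.re ≤ (g / ε) ^ c :=
    Real.rpow_le_rpow_of_exponent_le ((one_le_div hε).2 hεg.le) hs
  calc ε ^ ((n : ℂ) - s).re * (‖tubeNumerator n κ g s‖ / ‖expPoly 1 r s‖)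
      ≤ ε ^ ((n : ℂ) - s).re * (g ^ s.re * (C / ‖s‖ ^ 2) / δ) := by gcongr
    _ = (ε ^ ((n : ℂ) - s).re * g ^ s.re) * (C / ‖s‖ ^ 2) / δ := by ring
    _ ≤ (ε ^ (n : ℝ) * (g / ε) ^ c) * (C / ‖s‖ ^ 2) / δ := by
      rw [e]
      gcongr
    _ = ε ^ (n : ℝ) * (g / ε) ^ c * C / δ / ‖s‖ ^ 2 := by ring

/-- The residues in a window as an integral over a vertical segment, with a small error. -/
theorem norm_sum_residue_sub_le (hr : ∀ j, 0 < r j ∧ r j < 1) {D : ℝ} (hD : ∑ j, r j ^ D = 1)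
    {c : ℝ} (hDc : D < c) (hc0 : 0 < c) (hnc : (n : ℝ) - 1 < c) (hcn : c < n) (hε : 0 < ε)
    (hεg : ε < g) {T δ σ₀ B : ℝ} (hδ : 0 < δ) (hB : 0 ≤ B)
    (hBs : ∀ s : ℂ, s.re ≤ c → (n : ℝ) + 1 ≤ ‖s‖ → δ ≤ ‖expPoly 1 r s‖ →
      ‖tubeIntegrand n r κ g ε s‖ ≤ B / ‖s‖ ^ 2)
    (hT : ∀ s : ℂ, s.re ≤ c → |s.im| = T → δ ≤ ‖expPoly 1 r s‖)
    (hσ : ∀ s : ℂ, s.re ≤ σ₀ → δ ≤ ‖expPoly 1 r s‖) (hTσ : -σ₀ ≤ T) (hTn : (n : ℝ) + 1 ≤ T) :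
    ‖(∑ᶠ ω ∈ {ω ∈ tubePoles n r | |ω.im| ≤ T}, residue (tubeIntegrand n r κ g ε) ω) -
      (1 / (2 * Real.pi) : ℝ) • ∫ t in -T..T, tubeIntegrand n r κ g ε (c + t * Complex.I)‖ ≤
      (2 * (c + T) + 2 * T) * (B / T ^ 2) := by
  have hpos j := (hr j).1
  have hg := hε.trans hεg
  have hT0 : 0 < T := lt_of_lt_of_le (by positivity) hTn
  set f := tubeIntegrand n r κ g ε with hf
  have hfin := finite_tubePoles_window n hr hD T
  -- The left edge recedes together with the height. The lower bounds on the denominator keep its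
  -- zeros off the boundary, so the open rectangle contains exactly the poles of the window.
  set z : ℂ := ⟨-T, -T⟩ with hz
  set w : ℂ := ⟨c, T⟩ with hw
  have hres : rectIntegral f z w = 2 * Real.pi * Complex.I *
      ∑ ω ∈ hfin.toFinset, residue f ω := by
    refine rectIntegral_eq_sum_residue (by simp [hz, hw]; linarith) (by simp [hz, hw]; linarith)
      _ (fun ω hω => ?_) (fun ω _ => meromorphicAt_tubeIntegrand hpos hg hε ω) fun s hs hsP => ?_
    · obtain ⟨hω | ⟨i, hi, rfl⟩, hωT⟩ := hfin.mem_toFinset.1 hω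
      · have h0 : expPoly 1 r ω = 0 := by
          rw [expPoly_one]
          exact hω
        have hre := (re_le_of_mem_complexDimensions hr hD hω).trans_lt hDc
        refine ⟨⟨?_, hre⟩, abs_lt.1 (lt_of_le_of_ne hωT fun h => ?_)⟩
        · change -T < ω.re
          by_contra! h
          have := hσ ω (by linarith)
          rw [h0, norm_zero] at this
          linarith
        · have := hT ω hre.le h
          rw [h0, norm_zero] at this
          linarith
      · have hi' : (i : ℝ) + 1 ≤ n := by exact_mod_cast hi
        have hi0 : (0 : ℝ) ≤ i := Nat.cast_nonneg i
        refine ⟨⟨?_, ?_⟩, ?_, ?_⟩ <;> simp [hz, hw] <;> linarith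
    · refine differentiableAt_tubeIntegrand hpos hg hε (fun h => hsP ?_) ?_
      · exact hfin.mem_toFinset.2 ⟨h, abs_le.2 hs.2⟩
      · rintro rfl
        have : (n : ℝ) ≤ c := by simpa [hw] using hs.1.2
        linarith
  have hbound : ∀ s : ℂ, s.re ≤ c → T ≤ ‖s‖ → δ ≤ ‖expPoly 1 r s‖ → ‖f s‖ ≤ B / T ^ 2 := by
    intro s hs hsT hsd
    refine (hBs s hs (hTn.trans hsT) hsd).trans ?_
    gcongr
  have hor : ∀ y : ℝ, |y| = T →
      ‖∫ x : ℝ in -T..c, f (x + y * Complex.I)‖ ≤ B / T ^ 2 * (c + T) := by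
    intro y hy
    have h := intervalIntegral.norm_integral_le_of_norm_le_const (a := -T) (b := c)
      (f := fun x : ℝ => f (x + y * Complex.I)) (C := B / T ^ 2) fun x hx => by
        rw [uIoc_of_le (by linarith)] at hx
        refine hbound _ (by simpa using hx.2) ?_ (hT _ (by simpa using hx.2) (by simpa using hy))
        refine le_trans (le_of_eq ?_) (Complex.abs_im_le_norm _)
        simpa using hy.symm
    rwa [sub_neg_eq_add, abs_of_pos (by linarith)] at h
  have hver : ‖∫ y : ℝ in -T..T, f ((-T : ℝ) + y * Complex.I)‖ ≤ B / T ^ 2 * (2 * T) := by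
    have h := intervalIntegral.norm_integral_le_of_norm_le_const (a := -T) (b := T)
      (f := fun y : ℝ => f ((-T : ℝ) + y * Complex.I)) (C := B / T ^ 2) fun y _ => by
        refine hbound _ (by simp; linarith) ?_ (hσ _ (by simp; linarith))
        refine le_trans (le_of_eq ?_) (Complex.abs_re_le_norm _)
        simp [abs_of_pos hT0]
    rwa [sub_neg_eq_add, abs_of_pos (by linarith), ← two_mul] at h
  rw [finsum_mem_eq_finite_toFinset_sum _ hfin]
  have h1 := hor (-T) (by rw [abs_neg, abs_of_pos hT0])
  have h2 := hor T (abs_of_pos hT0)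
  unfold rectIntegral at hres
  simp only [hz, hw] at hres
  generalize (∫ x : ℝ in -T..c, f (x + (-T : ℝ) * Complex.I)) = b₁ at *
  generalize (∫ x : ℝ in -T..c, f (x + T * Complex.I)) = b₂ at *
  generalize (∫ y : ℝ in -T..T, f ((-T : ℝ) + y * Complex.I)) = b₃ at *
  generalize (∫ y : ℝ in -T..T, f (c + y * Complex.I)) = b₄ at *
  generalize (∑ ω ∈ hfin.toFinset, residue f ω) = R at *
  have hpi : (0 : ℝ) < 2 * Real.pi := Real.two_pi_pos
  have hpiC : (2 * Real.pi : ℂ) ≠ 0 := by exact_mod_cast hpi.ne'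
  -- The residue theorem is solved for the right edge `b₄`; the other three edges form the error.
  have e : R - (1 / (2 * Real.pi) : ℝ) • b₄ =
      (2 * Real.pi : ℂ)⁻¹ * (-Complex.I * (b₁ - b₂) - b₃) := by
    rw [eq_inv_mul_iff_mul_eq₀ hpiC, Complex.real_smul]
    have h3 : 2 * Real.pi * R = -Complex.I * (2 * Real.pi * Complex.I * R) := by
      linear_combination (2 * Real.pi * R) * Complex.I_mul_I
    push_cast
    rw [mul_sub, h3, ← hres]
    field_simp
    linear_combination (b₃ - b₄) * Complex.I_mul_I
  have hn : ‖(2 * Real.pi : ℂ)⁻¹‖ ≤ 1 := by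
    rw [norm_inv, norm_mul, Complex.norm_ofNat, Complex.norm_real, Real.norm_eq_abs,
      abs_of_pos Real.pi_pos]
    exact inv_le_one_of_one_le₀ (by linarith [Real.pi_gt_three])
  have h4 : ‖-Complex.I * (b₁ - b₂) - b₃‖ ≤ (‖b₁‖ + ‖b₂‖) + ‖b₃‖ := by
    refine (norm_sub_le _ _).trans (add_le_add ?_ le_rfl)
    rw [norm_mul, norm_neg, Complex.norm_I, one_mul]
    exact norm_sub_le _ _
  rw [e, norm_mul]
  refine (mul_le_of_le_one_left (norm_nonneg _) hn).trans (h4.trans ?_)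
  linarith

/-- The residues in growing windows sum to the integral over a vertical line. -/
theorem tendsto_sum_residue (hr : ∀ j, 0 < r j ∧ r j < 1) {D : ℝ} (hD : ∑ j, r j ^ D = 1)
    {c : ℝ} (hDc : D < c) (hc0 : 0 < c) (hnc : (n : ℝ) - 1 < c) (hcn : c < n) (hε : 0 < ε)
    (hεg : ε < g) (h0 : ∑ i ∈ Finset.range (n + 1), κ i / g ^ i = 0)
    {T : ℕ → ℝ} {δ : ℝ} (hδ : 0 < δ) (hTlim : Tendsto T atTop atTop)
    (hT : ∀ m (s : ℂ), s.re ≤ c → |s.im| = T m → δ ≤ ‖expPoly 1 r s‖) :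
    Tendsto (fun m => ∑ᶠ ω ∈ {ω ∈ tubePoles n r | |ω.im| ≤ T m},
      residue (tubeIntegrand n r κ g ε) ω) atTop
      (𝓝 ((1 / (2 * Real.pi) : ℝ) • ∫ t : ℝ, tubeIntegrand n r κ g ε (c + t * Complex.I))) := by
  have hJ : 0 < J := by
    rcases Nat.eq_zero_or_pos J with rfl | h
    · simp at hD
    · exact h
  have hpos j := (hr j).1
  obtain ⟨σ₀, -, hσ⟩ := exists_one_le_norm_expPoly_left hr hJ
  have hδ' : 0 < min δ 1 := lt_min hδ one_pos
  obtain ⟨B, hB, hBs⟩ := exists_norm_tubeIntegrand_le (r := r) hε hεg h0 c hδ'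
  have hint := integrable_tubeIntegrand_vertical hpos (hε.trans hεg) h0 hc0 hnc hcn
    (sum_rpow_lt_one hr hD hDc) hε
  have hmain := (intervalIntegral_tendsto_integral hint (tendsto_neg_atTop_atBot.comp hTlim)
    hTlim).const_smul (1 / (2 * Real.pi) : ℝ)
  -- Edges of length `O(T)` against an integrand of size `O(T^(-2))` leave `O(1/T)`.
  have herr : Tendsto (fun m => (2 * (c + T m) + 2 * T m) * (B / T m ^ 2)) atTop (𝓝 0) := by
    have h1 : Tendsto (fun m => (T m)⁻¹) atTop (𝓝 0) := tendsto_inv_atTop_zero.comp hTlim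
    have h2 : Tendsto (fun m => 2 * c * B * ((T m)⁻¹ * (T m)⁻¹) + 4 * B * (T m)⁻¹) atTop
        (𝓝 (2 * c * B * (0 * 0) + 4 * B * 0)) :=
      ((h1.mul h1).const_mul _).add (h1.const_mul _)
    simp only [mul_zero, add_zero] at h2
    refine h2.congr' ?_
    filter_upwards [hTlim.eventually_gt_atTop 0] with m hm
    field_simp
    ring
  have hdiff := squeeze_zero_norm' (f := fun m =>
    (∑ᶠ ω ∈ {ω ∈ tubePoles n r | |ω.im| ≤ T m}, residue (tubeIntegrand n r κ g ε) ω) -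
      (1 / (2 * Real.pi) : ℝ) • ∫ t in -T m..T m, tubeIntegrand n r κ g ε (c + t * Complex.I))
    (a := fun m => (2 * (c + T m) + 2 * T m) * (B / T m ^ 2)) (by
      filter_upwards [hTlim.eventually_ge_atTop (-σ₀), hTlim.eventually_ge_atTop (n + 1 : ℝ)]
        with m hm1 hm2
      exact norm_sum_residue_sub_le hr hD hDc hc0 hnc hcn hε hεg hδ' hB hBs
        (fun s hs hs' => (min_le_left _ _).trans (hT m s hs hs'))
        (fun s hs => (min_le_right _ _).trans (hσ s hs)) hm1 hm2) herr
  simpa using hdiff.add hmain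

end Contour

/-! ### Monophase generators and the conclusion. -/

section Monophase

variable {n : ℕ} {G : Set (EuclideanSpace ℝ (Fin n))} {κ : ℕ → ℝ}

namespace IsMonophase

/-- The polynomial formula holds below the inradius only; left continuity of the tube volume extends
it to the inradius, where the volume is `Vol(G)`. -/
theorem sum_inradius (h : IsMonophase G κ) (hvol : volume G ≠ ⊤) (hg : 0 < inradius G) :
    ∑ i ∈ Finset.range n, κ i * inradius G ^ (n - i) = -κ n := by
  have h1 := tendsto_innerTubeVolume_left hvol (inradius G)
  have hcont : Continuous fun ε : ℝ => ∑ i ∈ Finset.range n, κ i * ε ^ (n - i) := by fun_prop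
  have h2 : Tendsto (innerTubeVolume G) (𝓝[<] inradius G)
      (𝓝 (∑ i ∈ Finset.range n, κ i * inradius G ^ (n - i))) := by
    refine ((hcont.tendsto _).mono_left nhdsWithin_le_nhds).congr' ?_
    filter_upwards [Ioo_mem_nhdsLT hg] with ε hε
    exact (h.tube_of_lt ε hε.1 hε.2).symm
  rw [tendsto_nhds_unique h2 h1, h.tube_of_ge _ le_rfl, h.top_coeff, neg_neg]

theorem sum_div_inradius (h : IsMonophase G κ) (hvol : volume G ≠ ⊤) (hg : 0 < inradius G) :
    ∑ i ∈ Finset.range (n + 1), κ i / inradius G ^ i = 0 := by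
  have e : ∑ i ∈ Finset.range n, κ i / inradius G ^ i =
      (∑ i ∈ Finset.range n, κ i * inradius G ^ (n - i)) / inradius G ^ n := by
    rw [Finset.sum_div]
    refine Finset.sum_congr rfl fun i hi => ?_
    have : inradius G ^ n = inradius G ^ (n - i) * inradius G ^ i := by
      rw [← pow_add, Nat.sub_add_cancel (Finset.mem_range.1 hi).le]
    rw [this]
    field_simp
  rw [Finset.sum_range_succ, e, h.sum_inradius hvol hg]
  ring

theorem innerTubeVolume_eq (h : IsMonophase G κ) (hvol : volume G ≠ ⊤) (hg : 0 < inradius G)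
    {ε : ℝ} (hε : 0 < ε) : innerTubeVolume G ε = monophaseTube n κ (inradius G) ε := by
  unfold monophaseTube
  rcases lt_or_ge ε (inradius G) with hlt | hge
  · rw [h.tube_of_lt ε hε hlt, min_eq_left hlt.le]
  · rw [h.tube_of_ge ε hge, min_eq_right hge, h.sum_inradius hvol hg, h.top_coeff, neg_neg]

end IsMonophase

/-- The inner tube volume of a spray with monophase generator as a vertical line integral. -/
theorem innerTubeVolume_spray_eq_integral {J : ℕ} {r : Fin J → ℝ} (hr : ∀ j, 0 < r j)
    (hG : IsOpen G) (hvol : volume G ≠ ⊤) (hκ : IsMonophase G κ)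
    {S : ℕ → Set (EuclideanSpace ℝ (Fin n))} (hS : IsSelfSimilarSpray r G S) {c : ℝ} (hc0 : 0 < c)
    (hnc : (n : ℝ) - 1 < c) (hcn : c < n) (hrc : ∑ j, r j ^ c < 1) {ε : ℝ} (hε : 0 < ε)
    (hg : 0 < inradius G) :
    volume (innerTube (⋃ k, S k) ε) ≠ ⊤ ∧ (innerTubeVolume (⋃ k, S k) ε : ℂ) =
      (1 / (2 * Real.pi) : ℝ) •
        ∫ t : ℝ, tubeIntegrand n r κ (inradius G) ε (c + t * Complex.I) := by
  have hn : n ≠ 0 := by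
    rintro rfl
    simp at hcn
    linarith
  have hpos := list_map_prod_pos hr
  have hsum := hasSum_monophaseTube hr hg (hκ.sum_inradius hvol hg) (hκ.sum_div_inradius hvol hg)
    hc0 hnc hcn hrc hε
  set a : List (Fin J) → ℝ := fun w =>
    (w.map r).prod ^ n * monophaseTube n κ (inradius G) (ε / (w.map r).prod) with ha
  -- Convergence of the complex series makes the nonnegative real one summable, which yields
  -- finiteness of the volume.
  have hsumR : Summable a := by
    exact (Complex.reCLM.summable hsum.summable).congr fun w => Complex.ofReal_re _
  have hvolw (w : List (Fin J)) : monophaseTube n κ (inradius G) (ε / (w.map r).prod) =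
      innerTubeVolume G (ε / (w.map r).prod) :=
    (hκ.innerTubeVolume_eq hvol hg (div_pos hε (hpos w))).symm
  have ha0 (w : List (Fin J)) : 0 ≤ a w := by
    simp only [ha, hvolw]
    exact mul_nonneg (pow_nonneg (hpos w).le n) ENNReal.toReal_nonneg
  have e : volume (innerTube (⋃ k, S k) ε) = ENNReal.ofReal (∑' w, a w) := by
    rw [volume_innerTube_spray hn hr hG hvol hS, ENNReal.ofReal_tsum_of_nonneg ha0 hsumR]
    refine tsum_congr fun w => ?_
    simp only [ha, hvolw, innerTubeVolume]
    rw [ENNReal.ofReal_mul (pow_nonneg (hpos w).le n), ENNReal.ofReal_toReal]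
    exact ne_top_of_le_ne_top hvol (measure_mono fun x hx => hx.1)
  refine ⟨e ▸ ENNReal.ofReal_ne_top, ?_⟩
  rw [innerTubeVolume, e, ENNReal.toReal_ofReal (tsum_nonneg ha0), Complex.ofReal_tsum]
  exact hsum.tsum_eq

end Monophase

end SelfSimilarSpray

theorem mainTheorem1 (n J : ℕ) (r : Fin J → ℝ) (hr : ∀ j, 0 < r j ∧ r j < 1)
    (D : ℝ) (hD : ∑ j, r j ^ D = 1) (hnD : (n : ℝ) - 1 < D) (hDn : D < (n : ℝ)) :
    ∃ T : ℕ → ℝ, StrictMono T ∧ Filter.Tendsto T Filter.atTop Filter.atTop ∧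
      (∀ m, {ω ∈ SelfSimilarSpray.tubePoles n r | |ω.im| ≤ T m}.Finite) ∧
      ∀ (G : Set (EuclideanSpace ℝ (Fin n))) (S : ℕ → Set (EuclideanSpace ℝ (Fin n)))
        (κ : ℕ → ℝ),
        IsOpen G → MeasureTheory.volume G ≠ ⊤ →
        SelfSimilarSpray.IsMonophase G κ →
        SelfSimilarSpray.IsSelfSimilarSpray r G S →
        ∀ ε : ℝ, 0 < ε → ε < SelfSimilarSpray.inradius G →
          MeasureTheory.volume (SelfSimilarSpray.innerTube (⋃ k, S k) ε) ≠ ⊤ ∧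
          Filter.Tendsto
            (fun m => ∑ᶠ ω ∈ {ω ∈ SelfSimilarSpray.tubePoles n r | |ω.im| ≤ T m},
              SelfSimilarSpray.residue
                (SelfSimilarSpray.tubeIntegrand n r κ (SelfSimilarSpray.inradius G) ε) ω)
            Filter.atTop
            (𝓝 (SelfSimilarSpray.innerTubeVolume (⋃ k, S k) ε : ℂ)) := by
  open SelfSimilarSpray in
  -- For `n = 0` one would have `D < 0`, so `J = ∑ r_j^0 < 1`, while the empty sum is not `1`.
  have hn : n ≠ 0 := by
    rintro rfl
    have h := sum_rpow_lt_one hr hD (c := 0) (by simpa using hDn)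
    simp only [Real.rpow_zero, Finset.sum_const, Finset.card_univ, Fintype.card_fin,
      nsmul_eq_mul, mul_one] at h
    obtain rfl : J = 0 := by exact_mod_cast Nat.lt_one_iff.1 (by exact_mod_cast h)
    simp at hD
  have hn1 : (1 : ℝ) ≤ n := by exact_mod_cast Nat.one_le_iff_ne_zero.2 hn
  -- The abscissa `c` is fixed before `G`, so the heights `T` taken from it are the same for every
  -- generator and spray.
  obtain ⟨c, hDc, hcn⟩ := exists_between hDn
  have hnc : (n : ℝ) - 1 < c := hnD.trans hDc
  have hc0 : 0 < c := by linarith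
  obtain ⟨T, δ, hmono, hlim, hδ, hT⟩ := exists_horizontal_lines hr hD c
  refine ⟨T, hmono, hlim, fun m => finite_tubePoles_window n hr hD (T m), ?_⟩
  intro G S κ hG hvol hκ hS ε hε hεg
  have hg := hε.trans hεg
  obtain ⟨hfin, hV⟩ := innerTubeVolume_spray_eq_integral (fun j => (hr j).1) hG hvol hκ hS hc0 hnc
    hcn (sum_rpow_lt_one hr hD hDc) hε hg
  refine ⟨hfin, ?_⟩
  rw [hV]
  exact tendsto_sum_residue hr hD hDc hc0 hnc hcn hε hεg (hκ.sum_div_inradius hvol hg) hδ hlim hT
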